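/- Let $(M,g,\nabla^M)$ and $(N,h,\nabla^N)$ be statistical manifolds, i.e. Riemannian manifolds with a torsion-free affine connection satisfying the Codazzi equation $(\nabla_Xg)(Y,Z)=(\nabla_Yg)(X,Z)$; all objects are smooth. On a statistical manifold $(N,h,\nabla)$ let $\nabla^h$ be the Levi-Civita connection, $K(X,Y)=\nabla_XY-\nabla^h_XY$ the difference tensor, $\overline\nabla$ the conjugate connection, defined by $X\,h(Y,Z)=h(\nabla_XY,Z)+h(Y,\overline\nabla_XZ)$, let $R(X,Y)Z=\nabla_X\nabla_YZ-\nabla_Y\nabla_XZ-\nabla_{[X,Y]}Z$ and $\overline R$ be the curvature tensors of $\nabla$ and $\overline\nabla$, and let $L$ and $\overline L$ be the tensors defined by $h(L(Z,W)X,Y)=h(R(X,Y)Z,W)$ and $h(\overline L(Z,W)X,Y)=h(\overline R(X,Y)Z,W)$. The manifold is called conjugate symmetric if $R=L$. A superscript $N$ indicates that these objects belong to $(N,h,\nabla^N)$. Let $u:M\to N$ be a smooth map. Denote by $\nabla^u$, $\overline\nabla{}^u$, $\widehat\nabla{}^u$ the connections on $u^{-1}TN$ induced by $\nabla^N$, $\overline\nabla{}^N$,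 $\nabla^h$. Let $\tau(u)=\operatorname{tr}_g\{(X,Y)\mapsto\nabla^u_Xu_*Y-u_*\nabla^M_XY\}$ be the tension field, and let $\overline\tau(u)$ be the tension field of $u$ with $\nabla^M,\nabla^N$ replaced by their conjugate connections. For a section $V\in\Gamma(u^{-1}TN)$ and an orthonormal frame $e_1,\dots,e_m$ of $g$ put $$ \begin{aligned} \mathcal H_u(V)={}&\overline R^N(V,\overline\tau(u))\tau(u)+\sum_i(\overline\nabla^N_{u_*e_i}\overline R^N)(V,u_*e_i)\tau(u)+2\sum_i\overline R^N(V,u_*e_i)\overline\nabla{}^u_{e_i}\tau(u)\\ &+\sum_i(\overline\nabla^N_V\overline L^N)(\tau(u),u_*e_i)u_*e_i-2\sum_iL^N(u_*e_i,\tau(u))\overline\nabla{}^u_{e_i}V-(\overline\nabla^N_VK^N)(\tau(u),\tau(u)). \end{aligned} $$ Proposition. If $(N,h,\nabla^N)$ is conjugate symmetric, then for every $V\in\Gamma(u^{-1}TN)$, pointwise on $M$ and for every orthonormal frame $e_1,\dots,e_m$, $$ \begin{aligned} \langle\mathcal H_u(V),V\rangle=\Big\langle &R^N(V,\overline\tau(u))\tau(u)+2\sum_iR^N(V,u_*e_i)\widehat\nabla{}^u_{e_i}\tau(u)+\sum_i(\nabla^h_{\tau(u)}R^N)(V,u_*e_i)u_*e_i\\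 &-2\sum_iR^N(u_*e_i,\tau(u))\widehat\nabla{}^u_{e_i}V-(\overline\nabla^N_VK^N)(\tau(u),\tau(u)),\;V\Big\rangle . \end{aligned} $$ -/

import Mathlib

open Bundle FiberBundle Module
open scoped Manifold ContDiff

noncomputable section

namespace StatGeom

/-! ### Connections and tensors on one Riemannian manifold -/

section OneManifold

variable {E : Type*} [NormedAddCommGroup E] [NormedSpace ℝ E] [FiniteDimensional ℝ E]
  {H : Type*} [TopologicalSpace H] {I : ModelWithCorners ℝ E H}
  {M : Type*} [TopologicalSpace M] [ChartedSpace H M] [IsManifold I ∞ M]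

/-- A tangent vector at `x`, extended to a vector field that is smooth near `x`. Tensors below are
evaluated on tangent vectors through these extensions. -/
abbrev ext {x : M} (v : TangentSpace I x) : Π y : M, TangentSpace I y := extend E v

/-- The curvature `R(X, Y) Z = ∇_X ∇_Y Z - ∇_Y ∇_X Z - ∇_[X, Y] Z` of an affine connection. Recall
that `D σ x v` is `(∇_v σ)(x)`. -/
def curvature (D : CovariantDerivative I E (TangentSpace I : M → Type _)) (x : M)
    (X Y Z : TangentSpace I x) : TangentSpace I x :=
  D (fun y ↦ D (ext Z) y (ext Y y)) x X
    - D (fun y ↦ D (ext Z) y (ext X y)) x Y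
    - D (ext Z) x (VectorField.mlieBracket I (ext X) (ext Y) x)

/-- The covariant derivative `(∇_X A)(Y, Z) = ∇_X (A(Y, Z)) - A(∇_X Y, Z) - A(Y, ∇_X Z)` of a
`(1,2)`-tensor field. -/
def nablaTwo (D : CovariantDerivative I E (TangentSpace I : M → Type _))
    (A : Π y : M, TangentSpace I y → TangentSpace I y → TangentSpace I y) (x : M)
    (X Y Z : TangentSpace I x) : TangentSpace I x :=
  D (fun y ↦ A y (ext Y y) (ext Z y)) x X
    - A x (D (ext Y) x X) Z
    - A x Y (D (ext Z) x X)

/-- The covariant derivative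
`(∇_X A)(Y, Z) W = ∇_X (A(Y, Z) W) - A(∇_X Y, Z) W - A(Y, ∇_X Z) W - A(Y, Z) ∇_X W` of a
`(1,3)`-tensor field. -/
def nablaThree (D : CovariantDerivative I E (TangentSpace I : M → Type _))
    (A : Π y : M, TangentSpace I y → TangentSpace I y → TangentSpace I y → TangentSpace I y)
    (x : M) (X Y Z W : TangentSpace I x) : TangentSpace I x :=
  D (fun y ↦ A y (ext Y y) (ext Z y) (ext W y)) x X
    - A x (D (ext Y) x X) Z W
    - A x Y (D (ext Z) x X) W
    - A x Y Z (D (ext W) x X)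

variable [RiemannianBundle (fun x : M ↦ TangentSpace I x)]

variable (I) in
/-- An orthonormal basis of the tangent space at `x`. -/
def onb (x : M) :
    OrthonormalBasis (Fin (finrank ℝ E)) ℝ (TangentSpace I x) :=
  haveI : FiniteDimensional ℝ (TangentSpace I x) := inferInstanceAs (FiniteDimensional ℝ E)
  (stdOrthonormalBasis ℝ (TangentSpace I x)).reindex (finCongr rfl)

variable [IsContMDiffRiemannianBundle I ∞ E (fun x : M ↦ TangentSpace I x)]

set_option linter.unusedSectionVars false in
lemma mdiffAt_inner {x : M} {Y Z : Π y : M, TangentSpace I y} (hY : MDiffAt (T% Y) x)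
    (hZ : MDiffAt (T% Z) x) : MDiffAt (fun y ↦ (inner ℝ (Y y) (Z y) : ℝ)) x :=
  MDifferentiableAt.inner_bundle (IB := I) (F := E) (E := fun y : M ↦ TangentSpace I y)
    (b := fun y ↦ y) hY hZ

/-- `(g, ∇)` is a statistical structure: `∇` is smooth and torsion free and `∇ g` satisfies the
Codazzi equation. Here `D.derivMetricTensor x Y Z X` is `(∇_X g)(Y, Z)`. -/
structure IsStatistical (D : CovariantDerivative I E (TangentSpace I : M → Type _)) : Prop where
  smooth : CovariantDerivative.ContMDiffCovariantDerivative D ∞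
  torsion_free : D.torsion = 0
  codazzi : ∀ (x : M) (X Y Z : TangentSpace I x),
    D.derivMetricTensor x Y Z X = D.derivMetricTensor x X Z Y

/-- The conjugate connection, determined by `X g(Y, Z) = g(∇_X Y, Z) + g(Y, ∇bar_X Z)`: in an
orthonormal basis `b` of the tangent space,
`∇bar_X Z = ∑ i, (X g(b i, Z) - g(∇_X (b i), Z)) b i`. -/
def conjugate (D : CovariantDerivative I E (TangentSpace I : M → Type _)) :
    CovariantDerivative I E (TangentSpace I : M → Type _) where
  toFun Z x := ∑ i,
    (d% (fun y ↦ inner ℝ (ext (onb I x i) y) (Z y)) x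
      - innerSL ℝ (Z x) ∘L D (ext (onb I x i)) x).smulRight (onb I x i)
  isCovariantDerivativeOnUniv :=
    { add := by
        intro Z Z' x hZ hZ' _
        rw [← Finset.sum_add_distrib]
        refine Finset.sum_congr rfl fun i _ ↦ ?_
        have he := mdifferentiableAt_extend I E (onb I x i)
        ext v
        simp [inner_add_right, mvfderiv_fun_add (mdiffAt_inner he hZ) (mdiffAt_inner he hZ')]
        module
      leibniz := by
        intro Z f x hZ hf _
        ext v
        have he (i) := mdifferentiableAt_extend I E (onb I x i)
        simp [inner_smul_right, mvfderiv_fun_mul hf (mdiffAt_inner (he _) hZ)]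
        have hv : d% f x v • Z x =
            ∑ i, d% f x v • inner ℝ (onb I x i) (Z x) • onb I x i := by
          rw [← Finset.smul_sum, (onb I x).sum_repr']
        rw [hv, Finset.smul_sum, ← Finset.sum_add_distrib]
        refine Finset.sum_congr rfl fun i _ ↦ ?_
        module }

/-- Twice the value `g(∇_X Y, Z)` for the Levi-Civita connection, by the Koszul formula. -/
def koszul (X Y Z : Π y : M, TangentSpace I y) (x : M) : ℝ :=
  d% (fun y ↦ inner ℝ (Y y) (Z y)) x (X x)
    + d% (fun y ↦ inner ℝ (Z y) (X y)) x (Y x)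
    - d% (fun y ↦ inner ℝ (X y) (Y y)) x (Z x)
    + inner ℝ (VectorField.mlieBracket I X Y x) (Z x)
    - inner ℝ (VectorField.mlieBracket I X Z x) (Y x)
    - inner ℝ (VectorField.mlieBracket I Y Z x) (X x)

variable (I M) in
/-- The Levi-Civita connection of the Riemannian metric:
`∇_v Y = ∑ i j, g(b j, v) g(∇_(b j) Y, b i) b i` in an orthonormal basis `b` of the tangent space,
where `2 g(∇_(b j) Y, b i)` is given by the Koszul formula. -/
def leviCivita : CovariantDerivative I E (TangentSpace I : M → Type _) where
  toFun Y x := ∑ i, ∑ j,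
    (innerSL ℝ (onb I x j)).smulRight
      ((koszul (ext (onb I x j)) Y (ext (onb I x i)) x / 2) • onb I x i)
  isCovariantDerivativeOnUniv :=
    { add := by
        intro Y Y' x hY hY' _
        have he (i) := mdifferentiableAt_extend I E (onb I x i)
        have key (i j) : koszul (ext (onb I x j)) (Y + Y') (ext (onb I x i)) x =
            koszul (ext (onb I x j)) Y (ext (onb I x i)) x +
            koszul (ext (onb I x j)) Y' (ext (onb I x i)) x := by
          simp [koszul, inner_add_left, inner_add_right,
            mvfderiv_fun_add (mdiffAt_inner hY (he i)) (mdiffAt_inner hY' (he i)),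
            mvfderiv_fun_add (mdiffAt_inner (he j) hY) (mdiffAt_inner (he j) hY'),
            VectorField.mlieBracket_add_left hY hY', VectorField.mlieBracket_add_right hY hY']
          ring
        ext v
        simp only [key, _root_.sum_apply, _root_.add_apply,
          ContinuousLinearMap.smulRight_apply, ← Finset.sum_add_distrib]
        refine Finset.sum_congr rfl fun i _ ↦ Finset.sum_congr rfl fun j _ ↦ ?_
        module
      leibniz := by
        intro Y f x hY hf _
        have he (i) := mdifferentiableAt_extend I E (onb I x i)
        have key (i j) : koszul (ext (onb I x j)) (f • Y) (ext (onb I x i)) x =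
            f x * koszul (ext (onb I x j)) Y (ext (onb I x i)) x +
            2 * (d% f x (onb I x j) * inner ℝ (onb I x i) (Y x)) := by
          simp [koszul, inner_smul_left, inner_smul_right, inner_add_left,
            mvfderiv_fun_mul hf (mdiffAt_inner hY (he i)),
            mvfderiv_fun_mul hf (mdiffAt_inner (he j) hY),
            VectorField.mlieBracket_smul_left hf hY, VectorField.mlieBracket_smul_right hf hY]
          rw [real_inner_comm (Y x) (onb I x i),
            real_inner_comm (Y x) (onb I x j)]
          ring
        ext v
        simp only [key, _root_.sum_apply, _root_.add_apply, _root_.smul_apply,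
          ContinuousLinearMap.smulRight_apply, innerSL_apply_apply]
        have hv : d% f x v = ∑ j, inner ℝ (onb I x j) v * d% f x (onb I x j) := by
          conv_lhs => rw [← (onb I x).sum_repr' v]
          simp
        conv_rhs => rw [← (onb I x).sum_repr' (Y x)]
        rw [hv, Finset.smul_sum, Finset.smul_sum, ← Finset.sum_add_distrib]
        refine Finset.sum_congr rfl fun i _ ↦ ?_
        rw [Finset.smul_sum, Finset.sum_smul, ← Finset.sum_add_distrib]
        refine Finset.sum_congr rfl fun j _ ↦ ?_
        module }


/-- The difference tensor `K(X, Y) = ∇_X Y - ∇^g_X Y`. In `CovariantDerivative.difference` the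
argument that is differentiated comes first. -/
def differenceTensor (D : CovariantDerivative I E (TangentSpace I : M → Type _)) (x : M)
    (X Y : TangentSpace I x) : TangentSpace I x :=
  D.difference (leviCivita I M) x Y X

/-- The curvature interchange tensor `L`, determined by `g(L(Z, W) X, Y) = g(R(X, Y) Z, W)`. -/
def interchange (D : CovariantDerivative I E (TangentSpace I : M → Type _)) (x : M)
    (Z W X : TangentSpace I x) : TangentSpace I x :=
  ∑ i, inner ℝ (curvature D x X (onb I x i) Z) W • onb I x i

/-- Conjugate symmetry: `R = L`. -/
def IsConjugateSymmetric (D : CovariantDerivative I E (TangentSpace I : M → Type _)) : Prop :=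
  ∀ (x : M) (X Y Z : TangentSpace I x), curvature D x X Y Z = interchange D x X Y Z

end OneManifold

/-! ### Maps between statistical manifolds -/

section Maps

variable {E : Type*} [NormedAddCommGroup E] [NormedSpace ℝ E] [FiniteDimensional ℝ E]
  {H : Type*} [TopologicalSpace H] {I : ModelWithCorners ℝ E H}
  {M : Type*} [TopologicalSpace M] [ChartedSpace H M] [IsManifold I ∞ M]
  {E' : Type*} [NormedAddCommGroup E'] [NormedSpace ℝ E'] [FiniteDimensional ℝ E']
  {H' : Type*} [TopologicalSpace H'] {J : ModelWithCorners ℝ E' H'}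
  {N : Type*} [TopologicalSpace N] [ChartedSpace H' N] [IsManifold J ∞ N]

/-- The connection on `u⁻¹ TN` induced by a connection `D` of `N`, applied to a section `U`.
In the trivialization of `TN` around `u x`, in which `U` reads `y ↦ c y`, this is the usual formula
`∇^u_v U = dc(v) + D_(du(v)) C`, where `C` is the vector field on `N` with constant coordinates
`c x`. -/
def pullbackConn (D : CovariantDerivative J E' (TangentSpace J : N → Type _)) (u : M → N)
    (U : Π x : M, TangentSpace J (u x)) (x : M) : TangentSpace I x →L[ℝ] TangentSpace J (u x) :=
  letI t := trivializationAt E' (TangentSpace J : N → Type _) (u x)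
  t.symmL ℝ (u x) ∘L mvfderiv I (fun y ↦ (t ⟨u y, U y⟩).2) x
    + D (ext (U x)) (u x) ∘L mfderiv I J u x

/-- The second fundamental form `(X, Y) ↦ ∇^u_X (u_* Y) - u_* (∇^M_X Y)` of `u`. -/
def secondForm (DM : CovariantDerivative I E (TangentSpace I : M → Type _))
    (DN : CovariantDerivative J E' (TangentSpace J : N → Type _)) (u : M → N) (x : M)
    (X Y : TangentSpace I x) : TangentSpace J (u x) :=
  pullbackConn (I := I) DN u (fun y ↦ mfderiv I J u y (ext Y y)) x X
    - mfderiv I J u x (DM (ext Y) x X)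

variable [RiemannianBundle (fun x : M ↦ TangentSpace I x)]

/-- The tension field `τ(u)`: the trace of the second fundamental form. -/
def tension (DM : CovariantDerivative I E (TangentSpace I : M → Type _))
    (DN : CovariantDerivative J E' (TangentSpace J : N → Type _)) (u : M → N) (x : M) :
    TangentSpace J (u x) :=
  ∑ i, secondForm DM DN u x (onb I x i) (onb I x i)

variable [IsContMDiffRiemannianBundle I ∞ E (fun x : M ↦ TangentSpace I x)]
  [RiemannianBundle (fun x : N ↦ TangentSpace J x)]
  [IsContMDiffRiemannianBundle J ∞ E' (fun x : N ↦ TangentSpace J x)]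

/-- The operator `H_u` on sections of `u⁻¹ TN`, at the point `x`. Here `DN'` is the conjugate
connection of `DN`, `τ'` is the tension field of `u` for the two conjugate connections, `f i` is
`u_* e_i` for an orthonormal basis `e` of the tangent space at `x`, and `interchange DN'` is the
curvature interchange tensor of the conjugate connection. -/
def hOp (DM : CovariantDerivative I E (TangentSpace I : M → Type _))
    (DN : CovariantDerivative J E' (TangentSpace J : N → Type _)) (u : M → N)
    (V : Π x : M, TangentSpace J (u x)) (x : M) : TangentSpace J (u x) :=
  let DN' := conjugate DN
  let τ := tension DM DN u
  let τ' := tension (conjugate DM) DN' u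
  let f : Fin (finrank ℝ E) → TangentSpace J (u x) := fun i ↦ mfderiv I J u x (onb I x i)
  curvature DN' (u x) (V x) (τ' x) (τ x)
    + ∑ i, nablaThree DN' (curvature DN') (u x) (f i) (V x) (f i) (τ x)
    + (2 : ℝ) • ∑ i, curvature DN' (u x) (V x) (f i) (pullbackConn DN' u τ x (onb I x i))
    + ∑ i, nablaThree DN' (interchange DN') (u x) (V x) (τ x) (f i) (f i)
    - (2 : ℝ) • ∑ i, interchange DN (u x) (f i) (τ x) (pullbackConn DN' u V x (onb I x i))
    - nablaTwo DN' (differenceTensor DN) (u x) (V x) (τ x) (τ x)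

end Maps

end StatGeom

end

/-! Conjugate symmetry `R = L` says `⟨R(a,b)c,d⟩ = ⟨R(c,d)a,b⟩`. With antisymmetry in the first pair
this makes `R` skew in its last pair. Duality of the two connections always gives `⟨R(a,b)c,d⟩ =
-⟨c, Rbar(a,b)d⟩`, so all four tensors `R`, `Rbar`, `L`, `Lbar` coincide (`curvature_conjugate`,
`interchange_conjugate`).

What remains is to trade the conjugate connection for the Levi-Civita connection. The latter is the
average of the two dual connections, so they are `∇^h + K` and `∇^h - K`, with `K` symmetric and
each `K(v, ·)` self-adjoint. Replacing the induced connections in `H_u` produces curvature terms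
containing `K`, and these must combine with the two terms `∇bar R` into `∇^h_τ R`.

This is an identity for each frame vector separately (`conjugateSymmetric_identity`). Since `R =
Rbar`, the one tensor `R` satisfies the second Bianchi identity for both `∇` and `∇bar`. The sum of
the two identities is the Bianchi identity for `∇^h R`; their difference is a cyclic relation among
the `K`-terms. With the algebraic symmetries of `R` and `∇^h R`, these two relations suffice
(`curvature_identity`).

Finally, every sum over the frame is a trace of a bilinear form, so the fixed orthonormal basis in
`hOp` may be replaced by an arbitrary one (`sum_onb_eq`). -/

noncomputable section

namespace StatGeom

/-! ### Global smooth vector fields and their action on functions -/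

section SmoothFields

open scoped Topology

variable {E : Type*} [NormedAddCommGroup E] [NormedSpace ℝ E]
  {H : Type*} [TopologicalSpace H] {I : ModelWithCorners ℝ E H}
  {M : Type*} [TopologicalSpace M] [ChartedSpace H M] [IsManifold I ∞ M]

/-- A globally defined smooth vector field. -/
def SmoothField (X : Π y : M, TangentSpace I y) : Prop := CMDiff ∞ (T% X)

/-- The vector field `∇_X Y`. -/
def nabla (D : CovariantDerivative I E (TangentSpace I : M → Type _))
    (X Y : Π y : M, TangentSpace I y) (y : M) : TangentSpace I y := D Y y (X y)

/-- The derivative of `f` along the vector field `X`. -/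
def lieDeriv (X : Π y : M, TangentSpace I y) (f : M → ℝ) (y : M) : ℝ := d% f y (X y)

variable {X Y Z : Π y : M, TangentSpace I y} {f g : M → ℝ} {x : M}

namespace SmoothField

lemma mdiffAt (hX : SmoothField X) : MDiffAt (T% X) x :=
  (ContMDiff.contMDiffAt hX).mdifferentiableAt (by simp)

lemma add (hX : SmoothField X) (hY : SmoothField Y) : SmoothField (X + Y) :=
  ContMDiff.add_section hX hY

lemma sub (hX : SmoothField X) (hY : SmoothField Y) : SmoothField (X - Y) :=
  ContMDiff.sub_section hX hY

lemma smul (hf : CMDiff ∞ f) (hX : SmoothField X) : SmoothField (f • X) :=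
  ContMDiff.smul_section hf hX

lemma const_smul (a : ℝ) (hX : SmoothField X) : SmoothField (a • X) :=
  ContMDiff.const_smul_section hX

lemma bracket [CompleteSpace E] (hX : SmoothField X) (hY : SmoothField Y) :
    SmoothField (VectorField.mlieBracket I X Y) := fun x ↦
  haveI : IsManifold I (((⊤ : ℕ∞) : ℕ∞ω) + 1) M := inferInstanceAs (IsManifold I ∞ M)
  haveI : IsManifold I (minSmoothness ℝ 2) M := by simp; infer_instance
  ContMDiffAt.mlieBracket_vectorField (m := ⊤) (n := ⊤) (hX x) (hY x) (by simp)

lemma nabla {D : CovariantDerivative I E (TangentSpace I : M → Type _)}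
    (hD : CovariantDerivative.ContMDiffCovariantDerivative D ∞) (hX : SmoothField X)
    (hY : SmoothField Y) : SmoothField (nabla D X Y) := by
  have h := hD.contMDiff.contMDiff (σ := Y) (contMDiffOn_univ.2 hY)
  exact ContMDiff.clm_bundle_apply (contMDiffOn_univ.1 h) hX

lemma contMDiff_inner [RiemannianBundle (fun x : M ↦ TangentSpace I x)]
    [IsContMDiffRiemannianBundle I ∞ E (fun x : M ↦ TangentSpace I x)]
    (hX : SmoothField X) (hY : SmoothField Y) : CMDiff ∞ (fun y ↦ (inner ℝ (X y) (Y y) : ℝ)) :=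
  ContMDiff.inner_bundle (IB := I) (F := E) (E := fun y : M ↦ TangentSpace I y)
    (b := fun y ↦ y) hX hY

lemma lieDeriv (hX : SmoothField X) (hf : CMDiff ∞ f) : CMDiff ∞ (lieDeriv X f) := by
  have h1 := hf.contMDiff_tangentMap (m := ∞) (by simp)
  have h2 := (contMDiff_snd_tangentBundle_modelSpace ℝ 𝓘(ℝ, ℝ) (n := ∞)).comp (h1.comp hX)
  exact h2

end SmoothField

section Extension

variable [FiniteDimensional ℝ E] [T2Space M]

/-- Multiplication by a bump function that equals one near `x` and is supported where `X` is smooth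
leaves the germ of `X` at `x` unchanged. -/
lemma exists_smoothField_eventuallyEq {u : Set M} (hu : u ∈ 𝓝 x) (hX : CMDiff[u] ∞ (T% X)) :
    ∃ Y : Π y : M, TangentSpace I y, SmoothField Y ∧ ∀ᶠ y in 𝓝 x, Y y = X y := by
  obtain ⟨v, hvu, hv, hxv⟩ := mem_nhds_iff.1 hu
  obtain ⟨f, hf, -⟩ := (SmoothBumpFunction.nhds_basis_support (I := I) (hv.mem_nhds hxv)).mem_iff.1
    (hv.mem_nhds hxv)
  refine ⟨(f : M → ℝ) • X,
    ContMDiffOn.smul_section_of_tsupport f.contMDiff.contMDiffOn hv hf (hX.mono hvu), ?_⟩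
  filter_upwards [f.eventuallyEq_one] with y hy
  simp [hy]

lemma exists_smoothField_extend (v : TangentSpace I x) :
    ∃ X : Π y : M, TangentSpace I y, SmoothField X ∧ ∀ᶠ y in 𝓝 x, X y = ext v y := by
  obtain ⟨u, hu, h⟩ := exists_contMDiffOn_extend (k := ∞) I E v
  exact exists_smoothField_eventuallyEq hu h

/-- A smooth vector field that agrees with `ext v` near `x`. -/
def globalExt (v : TangentSpace I x) : Π y : M, TangentSpace I y :=
  (exists_smoothField_extend v).choose

lemma smoothField_globalExt (v : TangentSpace I x) : SmoothField (globalExt v) :=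
  (exists_smoothField_extend v).choose_spec.1

lemma globalExt_eventuallyEq (v : TangentSpace I x) : ∀ᶠ y in 𝓝 x, globalExt v y = ext v y :=
  (exists_smoothField_extend v).choose_spec.2

@[simp] lemma globalExt_self (v : TangentSpace I x) : globalExt v x = v := by
  simpa using (globalExt_eventuallyEq v).self_of_nhds

end Extension

section Derivation

/-- Read off from the Jacobi identity: applied to `X, Y, f • Z` and compared with `f` times the
identity for `X, Y, Z`, it leaves the claimed scalar relation multiplied by `Z`. -/
lemma lieDeriv_bracket [FiniteDimensional ℝ E] [T2Space M] (hX : SmoothField X)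
    (hY : SmoothField Y) (hf : CMDiff ∞ f) :
    lieDeriv (VectorField.mlieBracket I X Y) f x =
      lieDeriv X (lieDeriv Y f) x - lieDeriv Y (lieDeriv X f) x := by
  -- The scalar can be cancelled only against a nonzero value of `Z`. If the tangent space is
  -- trivial, both sides are derivatives in the zero direction.
  by_cases hx : ∃ v : TangentSpace I x, v ≠ 0
  · obtain ⟨v, hv⟩ := hx
    set Z := globalExt v
    have hZ : SmoothField Z := smoothField_globalExt v
    have hm : IsManifold I (minSmoothness ℝ 3) M := by simp; infer_instance
    have md {f : M → ℝ} (hf : CMDiff ∞ f) {x} : MDiffAt f x := hf.contMDiffAt.mdifferentiableAt (by simp)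
    have hs {X} (hX : SmoothField (I := I) (M := M) X) : CMDiffAt (minSmoothness ℝ 2) (T% X) x := by
      refine (ContMDiff.contMDiffAt hX).of_le ?_
      simpa using (WithTop.coe_le_coe.2 le_top : ((2 : ℕ∞) : ℕ∞ω) ≤ ∞)
    have sr {X Z} (hZ : SmoothField (I := I) (M := M) Z) {f : M → ℝ} (hf : CMDiff ∞ f) :
        VectorField.mlieBracket I X (f • Z) =
          lieDeriv X f • Z + f • VectorField.mlieBracket I X Z := by
      funext y
      exact VectorField.mlieBracket_smul_right (md hf) hZ.mdiffAt
    have J1 := VectorField.leibniz_identity_mlieBracket_apply (hs hX) (hs hY) (hs (.smul hf hZ))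
    have J2 := VectorField.leibniz_identity_mlieBracket_apply (hs hX) (hs hY) (hs hZ)
    rw [sr hZ hf, sr hZ hf, sr hZ hf, 
      VectorField.mlieBracket_add_right (SmoothField.smul (hY.lieDeriv hf) hZ).mdiffAt 
        (SmoothField.smul hf (hY.bracket hZ)).mdiffAt, 
      VectorField.mlieBracket_add_right (SmoothField.smul (hX.lieDeriv hf) hZ).mdiffAt 
        (SmoothField.smul hf (hX.bracket hZ)).mdiffAt, sr hZ (hY.lieDeriv hf), sr hZ (hX.lieDeriv hf),
        sr (hY.bracket hZ) hf, sr (hX.bracket hZ) hf] at J1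
    simp only [Pi.add_apply, Pi.smul_apply', J2] at J1
    have hZx : Z x = v := globalExt_self v
    rw [hZx] at J1
    have : (lieDeriv (VectorField.mlieBracket I X Y) f x -
      (lieDeriv X (lieDeriv Y f) x - lieDeriv Y (lieDeriv X f) x)) • v = 0 := by
      linear_combination (norm := module) (-1 : ℝ) • J1
    rcases smul_eq_zero.1 this with h | h
    · linarith
    · exact absurd h hv
  · push Not at hx
    simp [lieDeriv, hx]

end Derivation

end SmoothFields

/-! ### Smooth dependence of determinants -/

section Det

variable {E : Type*} [NormedAddCommGroup E] [NormedSpace ℝ E]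
  {H : Type*} [TopologicalSpace H] {I : ModelWithCorners ℝ E H}
  {M : Type*} [TopologicalSpace M] [ChartedSpace H M]
  {ι : Type*} [Fintype ι] [DecidableEq ι]

lemma contMDiffAt_det {A : M → Matrix ι ι ℝ} {x : M}
    (hA : ∀ i j, CMDiffAt ∞ (fun y ↦ A y i j) x) : CMDiffAt ∞ (fun y ↦ (A y).det) x := by
  simp only [Matrix.det_apply']
  exact contMDiffAt_finsetSum fun σ _ ↦ contMDiffAt_const.mul
    (contMDiffAt_finsetProd fun i _ ↦ hA _ _)

end Det

/-! ### Dual connections and the Levi-Civita connection as their average -/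

section DualConnections

open scoped Topology

variable {E : Type*} [NormedAddCommGroup E] [NormedSpace ℝ E] [FiniteDimensional ℝ E]
  {H : Type*} [TopologicalSpace H] {I : ModelWithCorners ℝ E H}
  {M : Type*} [TopologicalSpace M] [ChartedSpace H M] [IsManifold I ∞ M]

variable [RiemannianBundle (fun x : M ↦ TangentSpace I x)]

/-- A pair of smooth torsion-free connections that are conjugate with respect to the metric. -/
structure IsDualPair (D D' : CovariantDerivative I E (TangentSpace I : M → Type _)) : Prop where
  smooth_left {X Y : Π y : M, TangentSpace I y} :
    SmoothField X → SmoothField Y → SmoothField (nabla D X Y)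
  smooth_right {X Y : Π y : M, TangentSpace I y} :
    SmoothField X → SmoothField Y → SmoothField (nabla D' X Y)
  torsion_left : D.torsion = 0
  torsion_right : D'.torsion = 0
  dual {x : M} {Y Z : Π y : M, TangentSpace I y} (v : TangentSpace I x) :
    MDiffAt (T% Y) x → MDiffAt (T% Z) x →
    d% (fun y ↦ (inner ℝ (Y y) (Z y) : ℝ)) x v = inner ℝ (D Y x v) (Z x) + inner ℝ (Y x) (D' Z x v)

variable {D D' : CovariantDerivative I E (TangentSpace I : M → Type _)}

lemma IsDualPair.symm (h : IsDualPair D D') : IsDualPair D' D where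
  smooth_left := h.smooth_right
  smooth_right := h.smooth_left
  torsion_left := h.torsion_right
  torsion_right := h.torsion_left
  dual v hY hZ := by
    have := h.dual v hZ hY
    simp only [real_inner_comm] at this ⊢
    rw [this, add_comm]

/-- Differentiating the three inner products with suitably chosen roles of `D` and `D'`, and writing
the brackets by torsion-freeness, cancels everything but the two terms differentiated along `X`.
This identifies the Levi-Civita connection without a separate uniqueness argument. -/
lemma IsDualPair.koszul_eq (h : IsDualPair D D') {x : M} {X Y Z : Π y : M, TangentSpace I y}
    (hX : MDiffAt (T% X) x) (hY : MDiffAt (T% Y) x) (hZ : MDiffAt (T% Z) x) :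
    koszul X Y Z x = inner ℝ (D Y x (X x)) (Z x) + inner ℝ (D' Y x (X x)) (Z x) := by
  rw [koszul, h.dual _ hY hZ, h.dual _ hZ hX, h.symm.dual _ hX hY,
    ← D'.torsion_eq_zero_iff.1 h.torsion_right hX hY,
    ← D'.torsion_eq_zero_iff.1 h.torsion_right hX hZ,
    ← D.torsion_eq_zero_iff.1 h.torsion_left hY hZ]
  simp only [inner_sub_left, real_inner_comm]
  ring

variable [IsContMDiffRiemannianBundle I ∞ E (fun x : M ↦ TangentSpace I x)]

/-- A vector field is smooth if its inner products with all smooth vector fields are. -/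
lemma SmoothField.of_inner [T2Space M] {V : Π y : M, TangentSpace I y}
    (hV : ∀ Y : Π y : M, TangentSpace I y, SmoothField Y →
      CMDiff ∞ (fun y ↦ (inner ℝ (V y) (Y y) : ℝ))) : SmoothField V := by
  intro x
  classical
  let b := Module.finBasis ℝ E
  let t := trivializationAt E (TangentSpace I : M → Type _) x
  have hx : x ∈ t.baseSet := FiberBundle.mem_baseSet_trivializationAt' x
  have hs := t.isLocalFrameOn_localFrame_baseSet I ∞ b
  refine (contMDiffAt_iff_localFrameCoeff (e := t) b hx).2 fun i ↦ ?_
  have hF (i) : ∃ Y : Π y : M, TangentSpace I y, SmoothField Y ∧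
      ∀ᶠ y in 𝓝 x, Y y = t.localFrame b i y :=
    exists_smoothField_eventuallyEq (t.open_baseSet.mem_nhds hx) (hs.contMDiffOn i)
  choose F hF hFe using hF
  -- The frame coefficients `c` of `V` solve the Gram system `G c = w`, whose entries are smooth by
  -- hypothesis. Cramer's rule then writes each coefficient as a quotient of smooth determinants
  -- with nonvanishing denominator near `x`.
  let G (y : M) : Matrix _ _ ℝ := Matrix.of fun i j ↦ (inner ℝ (F i y) (F j y) : ℝ)
  let w (y : M) : Fin (finrank ℝ E) → ℝ := fun j ↦ inner ℝ (V y) (F j y)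
  let c (y : M) : Fin (finrank ℝ E) → ℝ := fun i ↦ t.localFrameCoeff I b i y (V y)
  have hGdet : (G x).det ≠ 0 := by
    have : LinearIndependent ℝ (fun i ↦ F i x) := by
      rw [funext fun i ↦ (hFe i).self_of_nhds]
      exact hs.linearIndependent hx
    have := Matrix.posDef_gram_of_linearIndependent (𝕜 := ℝ) this
    exact this.det_pos.ne'
  have hGs (i j) : CMDiffAt ∞ (fun y ↦ G y i j) x := ((hF i).contMDiff_inner (hF j)).contMDiffAt
  have hws (j) : CMDiffAt ∞ (fun y ↦ w y j) x := (hV _ (hF j)).contMDiffAt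
  have hdet := contMDiffAt_det hGs
  have hcr : CMDiffAt ∞ (fun y ↦ ((G y).updateCol i (w y)).det) x := by
    refine contMDiffAt_det fun j k ↦ ?_
    by_cases h : k = i
    · subst h; simpa using hws j
    · simpa [Matrix.updateCol_ne h] using hGs j k
  have hne : ∀ᶠ y in 𝓝 x, (G y).det ≠ 0 := hdet.continuousAt.eventually_ne hGdet
  refine (hcr.mul (hdet.inv₀ hGdet)).congr_of_eventuallyEq ?_
  filter_upwards [hne, t.eventually_eq_localFrame_sum_coeff_smul (I := I) b hx (s := V),
    Filter.eventually_all.2 hFe] with y hy hVy hFy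
  have key : (G y).mulVec (c y) = w y := by
    funext j
    simp only [Matrix.mulVec, dotProduct, G, w, Matrix.of_apply]
    conv_rhs => rw [hVy, sum_inner]
    refine Finset.sum_congr rfl fun k _ ↦ ?_
    rw [real_inner_smul_left, ← hFy k, real_inner_comm, mul_comm]
  have : (G y).cramer (w y) = (G y).det • c y := by
    rw [Matrix.cramer_eq_adjugate_mulVec, ← key, Matrix.mulVec_mulVec, Matrix.adjugate_mul,
      Matrix.smul_mulVec, Matrix.one_mulVec]
  have := congrFun this i
  rw [Matrix.cramer_apply] at this
  simp only [Pi.mul_apply, this, Pi.smul_apply, smul_eq_mul]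
  change c y i = _
  field_simp

lemma derivMetricTensor_swap (x : M) (X Y Z : TangentSpace I x) :
    D.derivMetricTensor x Y Z X = D.derivMetricTensor x Z Y X := by
  rw [CovariantDerivative.derivMetricTensor_apply_eq_extend,
    CovariantDerivative.derivMetricTensor_apply_eq_extend]
  simp only [real_inner_comm]
  ring

lemma derivMetricTensor_eq {x : M} {Y Z : Π y : M, TangentSpace I y} (hY : MDiffAt (T% Y) x)
    (hZ : MDiffAt (T% Z) x) (v : TangentSpace I x) :
    D.derivMetricTensor x (Y x) (Z x) v = d% (fun y ↦ (inner ℝ (Y y) (Z y) : ℝ)) x v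
      - inner ℝ (D Y x v) (Z x) - inner ℝ (Y x) (D Z x v) := by
  have := CovariantDerivative.derivMetricTensor_apply (V := (TangentSpace I : M → Type _))
    (X := ext v) (cov := D) x hY hZ
  simpa using this

/-- Exhibits the conjugate connection as `D` plus the tensor `∇g`, so that the Codazzi equation
controls its torsion. -/
lemma conjugate_apply {x : M} {Z : Π y : M, TangentSpace I y} (hZ : MDiffAt (T% Z) x)
    (v : TangentSpace I x) :
    conjugate D Z x v = D Z x v + ∑ i, D.derivMetricTensor x (onb I x i) (Z x) v • onb I x i := by
  have hd := fun i ↦ derivMetricTensor_eq (D := D) (mdifferentiableAt_extend I E (onb I x i)) hZ v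
  simp only [extend_apply_self] at hd
  simp only [hd]
  simp only [sub_smul, Finset.sum_sub_distrib, (onb I x).sum_repr']
  rw [add_sub_cancel, ← Finset.sum_sub_distrib]
  simp only [conjugate, _root_.sum_apply, ContinuousLinearMap.smulRight_apply]
  refine Finset.sum_congr rfl fun i _ ↦ ?_
  rw [← sub_smul, real_inner_comm (Z x)]
  rfl

/-- The definition of `conjugate` imposes duality only against extensions of basis vectors. It
passes to every `Y` because `∇g` is tensorial and linear in that slot. -/
lemma dual_conjugate {x : M} {Y Z : Π y : M, TangentSpace I y} (v : TangentSpace I x)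
    (hY : MDiffAt (T% Y) x) (hZ : MDiffAt (T% Z) x) :
    d% (fun y ↦ (inner ℝ (Y y) (Z y) : ℝ)) x v =
      inner ℝ (D Y x v) (Z x) + inner ℝ (Y x) (conjugate D Z x v) := by
  have := derivMetricTensor_eq (D := D) hY hZ v
  rw [conjugate_apply hZ, inner_add_right, inner_sum]
  have h : D.derivMetricTensor x (Y x) (Z x) v =
      ∑ i, inner ℝ (Y x) (D.derivMetricTensor x (onb I x i) (Z x) v • onb I x i) := by
    conv_lhs => rw [← (onb I x).sum_repr' (Y x)]
    let L : TangentSpace I x →ₗ[ℝ] ℝ :=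
      { toFun := fun w ↦ D.derivMetricTensor x w (Z x) v
        map_add' := fun a b ↦ congrArg (fun A ↦ A (Z x) v)
          ((D.derivMetricTensor x).map_add a b)
        map_smul' := fun a b ↦ congrArg (fun A ↦ A (Z x) v)
          ((D.derivMetricTensor x).map_smul a b) }
    refine (map_sum L _ _).trans (Finset.sum_congr rfl fun i _ ↦ ?_)
    rw [map_smul, inner_smul_right, real_inner_comm, smul_eq_mul, mul_comm]
    rfl
  rw [← h, this]
  ring

/-- Smoothness of the conjugate connection is tested by inner products, where duality expresses it
through `D`. Its torsion vanishes because Codazzi and the symmetry of `g` make the correction term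
symmetric in the two fields. -/
lemma IsStatistical.isDualPair [T2Space M] (h : IsStatistical D) :
    IsDualPair D (conjugate D) where
  smooth_left := SmoothField.nabla h.smooth
  smooth_right {X Z} hX hZ := by
    refine SmoothField.of_inner fun Y hY ↦ ?_
    have e : (fun y ↦ (inner ℝ (nabla (conjugate D) X Z y) (Y y) : ℝ)) = fun y ↦
        lieDeriv X (fun y ↦ (inner ℝ (Y y) (Z y) : ℝ)) y - inner ℝ (nabla D X Y y) (Z y) := by
      funext y
      rw [lieDeriv, dual_conjugate (D := D) _ hY.mdiffAt hZ.mdiffAt, real_inner_comm]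
      simp [nabla]
    rw [e]
    exact (hX.lieDeriv (hY.contMDiff_inner hZ)).sub
      ((SmoothField.nabla h.smooth hX hY).contMDiff_inner hZ)
  torsion_left := h.torsion_free
  torsion_right := by
    refine (conjugate D).torsion_eq_zero_iff.2 fun {X Y x} hX hY ↦ ?_
    rw [conjugate_apply hX, conjugate_apply hY, ← D.torsion_eq_zero_iff.1 h.torsion_free hX hY]
    have hs (i) : D.derivMetricTensor x (onb I x i) (Y x) (X x) =
        D.derivMetricTensor x (onb I x i) (X x) (Y x) := by
      rw [derivMetricTensor_swap, h.codazzi, derivMetricTensor_swap]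
    simp [hs]
  dual := dual_conjugate

namespace IsDualPair

lemma leviCivita_apply (h : IsDualPair D D') {x : M} {Y : Π y : M, TangentSpace I y}
    (hY : MDiffAt (T% Y) x) (v : TangentSpace I x) :
    leviCivita I M Y x v = (1 / 2 : ℝ) • (D Y x v + D' Y x v) := by
  have he (i) := mdifferentiableAt_extend I E (onb I x i)
  have hv (A : TangentSpace I x →L[ℝ] TangentSpace I x) :
      A v = ∑ j, inner ℝ (onb I x j) v • A (onb I x j) := by
    conv_lhs => rw [← (onb I x).sum_repr' v]
    simp
  rw [hv (D Y x), hv (D' Y x), ← (onb I x).sum_repr' ((1 / 2 : ℝ) • (_ + _))]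
  simp only [leviCivita, _root_.sum_apply, ContinuousLinearMap.smulRight_apply,
    innerSL_apply_apply, h.koszul_eq (he _) hY (he _), extend_apply_self]
  refine Finset.sum_congr rfl fun i _ ↦ ?_
  simp only [smul_smul, ← Finset.sum_smul]
  congr 1
  simp only [inner_smul_right, inner_add_right, inner_sum]
  rw [← Finset.sum_add_distrib, Finset.mul_sum]
  refine Finset.sum_congr rfl fun j _ ↦ ?_
  rw [real_inner_comm (onb I x i), real_inner_comm (onb I x i)]
  ring

/-- Smoothness and vanishing torsion pass to the average of `D` and `D'`; averaging the two duality
relations shows that this average is its own dual, i.e. metric. -/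
lemma isDualPair_leviCivita (h : IsDualPair D D') :
    IsDualPair (leviCivita I M) (leviCivita I M) := by
  have hs {X Y : Π y : M, TangentSpace I y} (hX : SmoothField X) (hY : SmoothField Y) :
      SmoothField (nabla (leviCivita I M) X Y) := by
    have e : nabla (leviCivita I M) X Y = (1 / 2 : ℝ) • (nabla D X Y + nabla D' X Y) :=
      funext fun y ↦ h.leviCivita_apply hY.mdiffAt _
    rw [e]
    exact ((h.smooth_left hX hY).add (h.smooth_right hX hY)).const_smul _
  have ht : (leviCivita I M).torsion = 0 := by
    refine (leviCivita I M).torsion_eq_zero_iff.2 fun {X Y x} hX hY ↦ ?_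
    rw [h.leviCivita_apply hX, h.leviCivita_apply hY]
    have h1 := D.torsion_eq_zero_iff.1 h.torsion_left hX hY
    have h2 := D'.torsion_eq_zero_iff.1 h.torsion_right hX hY
    linear_combination (norm := module) (1 / 2 : ℝ) • h1 + (1 / 2 : ℝ) • h2
  refine ⟨hs, hs, ht, ht, fun {x Y Z} v hY hZ ↦ ?_⟩
  rw [h.leviCivita_apply hY, h.leviCivita_apply hZ]
  simp only [real_inner_smul_left, real_inner_smul_right, inner_add_left, inner_add_right]
  linear_combination (1 / 2 : ℝ) * h.dual v hY hZ + (1 / 2 : ℝ) * h.symm.dual v hY hZ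

end IsDualPair

end DualConnections

/-! ### Curvature of vector fields: locality, first Bianchi identity, duality -/

section Curvature

open scoped Topology
open VectorField (mlieBracket)

variable {E : Type*} [NormedAddCommGroup E] [NormedSpace ℝ E]
  {H : Type*} [TopologicalSpace H] {I : ModelWithCorners ℝ E H}
  {M : Type*} [TopologicalSpace M] [ChartedSpace H M] [IsManifold I ∞ M]
  {D D' : CovariantDerivative I E (TangentSpace I : M → Type _)}
  {X X' Y Y' Z W : Π y : M, TangentSpace I y} {x : M}

/-- The curvature `∇_X ∇_Y Z - ∇_Y ∇_X Z - ∇_[X, Y] Z` of vector fields. -/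
def curvField (D : CovariantDerivative I E (TangentSpace I : M → Type _))
    (X Y Z : Π y : M, TangentSpace I y) : Π y : M, TangentSpace I y :=
  nabla D X (nabla D Y Z) - nabla D Y (nabla D X Z) - nabla D (mlieBracket I X Y) Z

lemma cov_congr (hX : MDiffAt (T% X) x) (h : ∀ᶠ y in 𝓝 x, X y = Y y) : D X x = D Y x := by
  refine D.isCovariantDerivativeOn.congr_of_eventuallyEq (s := Set.univ) hX ?_
    Filter.univ_mem h
  refine hX.congr_of_eventuallyEq ?_
  filter_upwards [h] with y hy
  rw [hy]

lemma cov_congr' (hX : MDiffAt (T% X) x) (h : ∀ᶠ y in 𝓝 x, X y = Y y) : D Y x = D X x :=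
  (cov_congr hX h).symm

lemma nabla_add_right (hY : SmoothField Y) (hZ : SmoothField Z) :
    nabla D X (Y + Z) = nabla D X Y + nabla D X Z := by
  funext y
  simp [nabla, D.isCovariantDerivativeOn.add (s := Set.univ) hY.mdiffAt hZ.mdiffAt]

lemma nabla_sub_right (hY : SmoothField Y) (hZ : SmoothField Z) :
    nabla D X (Y - Z) = nabla D X Y - nabla D X Z := by
  have := nabla_add_right (D := D) (X := X) (hY.sub hZ) hZ
  rw [sub_add_cancel] at this
  rw [this, add_sub_cancel_right]

lemma nabla_add_left : nabla D (X + Y) Z = nabla D X Z + nabla D Y Z := by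
  funext y; simp [nabla]

lemma nabla_neg_left : nabla D (-X) Z = -nabla D X Z := by
  funext y; simp [nabla]

lemma nabla_zero_left : nabla D (0 : Π y : M, TangentSpace I y) Z = 0 := by
  funext y; simp [nabla]

lemma curvField_swap : curvField D X Y Z = - curvField D Y X Z := by
  funext y
  simp only [curvField, Pi.sub_apply, Pi.neg_apply, nabla]
  rw [VectorField.mlieBracket_swap_apply, map_neg]
  abel

variable [FiniteDimensional ℝ E]

section

variable [T2Space M]

lemma cov_ext (v : TangentSpace I x) : ∀ᶠ y in 𝓝 x, D (globalExt v) y = D (ext v) y := by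
  filter_upwards [(globalExt_eventuallyEq v).eventually_nhds] with y hy
  exact cov_congr (smoothField_globalExt v).mdiffAt hy

/-- The extensions `ext` are smooth only near the point. Since the curvature depends only on germs,
they may be replaced by global fields, for which the calculus above is available. -/
lemma curvature_eq_curvField (hD : ∀ {X Y : Π y : M, TangentSpace I y},
      SmoothField X → SmoothField Y → SmoothField (nabla D X Y)) (v w z : TangentSpace I x) :
    curvature D x v w z = curvField D (globalExt v) (globalExt w) (globalExt z) x := by
  have h (a : TangentSpace I x) : D (fun y ↦ D (ext z) y (ext a y)) x =
      D (nabla D (globalExt a) (globalExt z)) x := by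
    refine cov_congr' (hD (smoothField_globalExt a) (smoothField_globalExt z)).mdiffAt ?_
    filter_upwards [globalExt_eventuallyEq a, cov_ext (D := D) z] with y h1 h2
    simp [nabla, h1, h2]
  have hb : mlieBracket I (ext v) (ext w) x =
      mlieBracket I (globalExt v) (globalExt w) x :=
    (Filter.EventuallyEq.mlieBracket_vectorField_eq
      (globalExt_eventuallyEq v) (globalExt_eventuallyEq w)).symm
  simp only [curvature, curvField, h, hb, nabla, Pi.sub_apply, globalExt_self,
    ← (cov_ext (D := D) z).self_of_nhds]

/-- The covariant derivative of a `(1,3)`-tensor field, computed with global extensions. -/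
lemma nablaThree_eq
    {A : Π y : M, TangentSpace I y → TangentSpace I y → TangentSpace I y → TangentSpace I y}
    (hA : ∀ {X Y Z : Π y : M, TangentSpace I y}, SmoothField X → SmoothField Y → SmoothField Z →
      SmoothField (fun y ↦ A y (X y) (Y y) (Z y))) (v a b c : TangentSpace I x) :
    nablaThree D A x v a b c =
      D (fun y ↦ A y (globalExt a y) (globalExt b y) (globalExt c y)) x v
        - A x (D (globalExt a) x v) b c - A x a (D (globalExt b) x v) c
        - A x a b (D (globalExt c) x v) := by
  have h : D (fun y ↦ A y (ext a y) (ext b y) (ext c y)) x =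
      D (fun y ↦ A y (globalExt a y) (globalExt b y) (globalExt c y)) x := by
    refine cov_congr' (hA (smoothField_globalExt a) (smoothField_globalExt b)
      (smoothField_globalExt c)).mdiffAt ?_
    filter_upwards [globalExt_eventuallyEq a, globalExt_eventuallyEq b,
      globalExt_eventuallyEq c] with y h1 h2 h3
    rw [h1, h2, h3]
  rw [nablaThree, h, (cov_ext (D := D) a).self_of_nhds, (cov_ext (D := D) b).self_of_nhds,
    (cov_ext (D := D) c).self_of_nhds]

end

lemma jacobi_cyclic (hX : SmoothField X) (hY : SmoothField Y) (hZ : SmoothField Z) :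
    mlieBracket I X (mlieBracket I Y Z) + mlieBracket I Y (mlieBracket I Z X) +
      mlieBracket I Z (mlieBracket I X Y) = 0 := by
  have hm : IsManifold I (minSmoothness ℝ 3) M := by simp; infer_instance
  have hs {X} (hX : SmoothField (I := I) (M := M) X) : CMDiff (minSmoothness ℝ 2) (T% X) := by
    refine ContMDiff.of_le hX ?_
    simpa using (WithTop.coe_le_coe.2 le_top : ((2 : ℕ∞) : ℕ∞ω) ≤ ∞)
  have hj := VectorField.leibniz_identity_mlieBracket (hs hX) (hs hY) (hs hZ)
  have hn : mlieBracket I Y (-mlieBracket I Z X) = -mlieBracket I Y (mlieBracket I Z X) := by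
    funext y
    simpa using VectorField.mlieBracket_const_smul_right (I := I) (c := (-1 : ℝ)) (V := Y)
      (W := mlieBracket I Z X) (x := y) (hZ.bracket hX).mdiffAt
  rw [VectorField.mlieBracket_swap (V := mlieBracket I X Y),
    VectorField.mlieBracket_swap (V := X) (W := Z), hn] at hj
  rw [hj]
  abel

lemma nabla_sub_nabla_swap (hD : D.torsion = 0) (hX : SmoothField X) (hY : SmoothField Y) :
    nabla D X Y - nabla D Y X = mlieBracket I X Y :=
  funext fun _ ↦ D.torsion_eq_zero_iff.1 hD hX.mdiffAt hY.mdiffAt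

variable [RiemannianBundle (fun x : M ↦ TangentSpace I x)]

namespace IsDualPair

lemma curvField_smooth (h : IsDualPair D D') (hX : SmoothField X) (hY : SmoothField Y)
    (hZ : SmoothField Z) : SmoothField (curvField D X Y Z) :=
  ((h.smooth_left hX (h.smooth_left hY hZ)).sub (h.smooth_left hY (h.smooth_left hX hZ))).sub
    (h.smooth_left (hX.bracket hY) hZ)

lemma lieDeriv_inner (h : IsDualPair D D') (hY : SmoothField Y)
    (hZ : SmoothField Z) : lieDeriv X (fun y ↦ (inner ℝ (Y y) (Z y) : ℝ)) =
      (fun y ↦ (inner ℝ (nabla D X Y y) (Z y) : ℝ)) + fun y ↦ inner ℝ (Y y) (nabla D' X Z y) :=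
  funext fun _ ↦ h.dual _ hY.mdiffAt hZ.mdiffAt

/-- Torsion-freeness, used twice, turns the cyclic sum into the cyclic sum of double brackets. -/
lemma bianchi_first (h : IsDualPair D D') (hX : SmoothField X) (hY : SmoothField Y)
    (hZ : SmoothField Z) :
    curvField D X Y Z + curvField D Y Z X + curvField D Z X Y = 0 := by
  have key {X Y Z} (hX : SmoothField (I := I) (M := M) X) (hY : SmoothField (I := I) (M := M) Y)
      (hZ : SmoothField (I := I) (M := M) Z) :
      nabla D X (nabla D Y Z) - nabla D X (nabla D Z Y) - nabla D (mlieBracket I Y Z) X =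
        mlieBracket I X (mlieBracket I Y Z) := by
    rw [← nabla_sub_right (h.smooth_left hY hZ) (h.smooth_left hZ hY),
      nabla_sub_nabla_swap h.torsion_left hY hZ,
      nabla_sub_nabla_swap h.torsion_left hX (hY.bracket hZ)]
  have h1 := key hX hY hZ
  have h2 := key hY hZ hX
  have h3 := key hZ hX hY
  have e : curvField D X Y Z + curvField D Y Z X + curvField D Z X Y =
      mlieBracket I X (mlieBracket I Y Z) + mlieBracket I Y (mlieBracket I Z X) +
        mlieBracket I Z (mlieBracket I X Y) := by
    rw [← h1, ← h2, ← h3]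
    simp only [curvField]
    abel
  rw [e, jacobi_cyclic hX hY hZ]

variable [IsContMDiffRiemannianBundle I ∞ E (fun x : M ↦ TangentSpace I x)]

/-- The bracket acts on the function `⟨Z, W⟩` as the commutator of derivations. Expanding by
duality, the mixed products of first derivatives cancel. -/
lemma inner_curvField [T2Space M] (h : IsDualPair D D') (hX : SmoothField X) (hY : SmoothField Y)
    (hZ : SmoothField Z) (hW : SmoothField W) :
    inner ℝ (curvField D X Y Z x) (W x) = - inner ℝ (Z x) (curvField D' X Y W x) := by
  have hl {X} {f g : M → ℝ} (hf : CMDiff ∞ f) (hg : CMDiff ∞ g) :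
      lieDeriv (I := I) (M := M) X (f + g) = lieDeriv X f + lieDeriv X g := by
    funext y
    simp [lieDeriv, mvfderiv_add (hf.contMDiffAt.mdifferentiableAt (by simp))
      (hg.contMDiffAt.mdifferentiableAt (by simp))]
  have key {X Y} (hX : SmoothField (I := I) (M := M) X) (hY : SmoothField (I := I) (M := M) Y) :
      lieDeriv X (lieDeriv Y (fun y ↦ (inner ℝ (Z y) (W y) : ℝ))) x =
        inner ℝ (nabla D X (nabla D Y Z) x) (W x) + inner ℝ (nabla D Y Z x) (nabla D' X W x) +
        (inner ℝ (nabla D X Z x) (nabla D' Y W x) + inner ℝ (Z x) (nabla D' X (nabla D' Y W) x)) := by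
    have s1 := h.smooth_left hY hZ
    have s2 := h.smooth_right hY hW
    rw [h.lieDeriv_inner hZ hW, hl (s1.contMDiff_inner hW) (hZ.contMDiff_inner s2),
      h.lieDeriv_inner s1 hW, h.lieDeriv_inner hZ s2]
    rfl
  have h1 := lieDeriv_bracket (x := x) hX hY (hZ.contMDiff_inner hW)
  rw [key hX hY, key hY hX, h.lieDeriv_inner hZ hW, Pi.add_apply] at h1
  simp only [curvField, Pi.sub_apply, inner_sub_left, inner_sub_right]
  linarith

end IsDualPair

end Curvature

/-! ### Tensoriality of the curvature and the second Bianchi identity -/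

section CurvatureTensor

open scoped Topology
open VectorField (mlieBracket)

variable {E : Type*} [NormedAddCommGroup E] [NormedSpace ℝ E] [FiniteDimensional ℝ E]
  {H : Type*} [TopologicalSpace H] {I : ModelWithCorners ℝ E H}
  {M : Type*} [TopologicalSpace M] [ChartedSpace H M] [IsManifold I ∞ M]
  {D D' : CovariantDerivative I E (TangentSpace I : M → Type _)}
  {X X' Y Y' Z Z' W : Π y : M, TangentSpace I y} {x : M}

/-- For `f • X`, the derivative of `f` along `Y` arising from `∇_Y ∇_(fX) Z` cancels the one arising
from `[fX, Y]`. -/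
lemma tensorialAt_curvField (hD : CovariantDerivative.ContMDiffCovariantDerivative D ∞)
    (hZ : SmoothField Z) : TensorialAt I E
      (fun X ↦ curvField D X Y Z x) x := by
  have hm {X : Π y : M, TangentSpace I y} (hX : MDiffAt (T% X) x) :
      MDiffAt (T% (nabla D X Z)) x := by
    have h := contMDiffOn_univ.1 (hD.contMDiff.contMDiff (σ := Z) (contMDiffOn_univ.2 hZ))
    exact MDifferentiableAt.clm_bundle_apply (h.contMDiffAt.mdifferentiableAt (by simp)) hX
  have hc (X : Π y : M, TangentSpace I y) : curvField D X Y Z x =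
      D (nabla D Y Z) x (X x) - D (nabla D X Z) x (Y x) - D Z x (mlieBracket I X Y x) := rfl
  constructor
  · intro f X hf hX
    have e : nabla D (f • X) Z = f • nabla D X Z := funext fun y ↦ by simp [nabla]
    rw [hc, hc, e, D.isCovariantDerivativeOn.leibniz (s := Set.univ) (hm hX) hf,
      VectorField.mlieBracket_smul_left hf hX]
    simp [nabla]
    module
  · intro X X' hX hX'
    have e : nabla D (X + X') Z = nabla D X Z + nabla D X' Z := nabla_add_left
    rw [hc, hc, hc, e, D.isCovariantDerivativeOn.add (s := Set.univ) (hm hX) (hm hX'),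
      VectorField.mlieBracket_add_left hX hX']
    simp
    abel

variable [RiemannianBundle (fun x : M ↦ TangentSpace I x)] [T2Space M]

lemma IsDualPair.curvature_swap (h : IsDualPair D D') (a b c : TangentSpace I x) :
    curvature D x a b c = - curvature D x b a c := by
  rw [curvature_eq_curvField h.smooth_left, curvature_eq_curvField h.smooth_left, curvField_swap,
    Pi.neg_apply]

lemma IsDualPair.exists_curvature_linear (hD : CovariantDerivative.ContMDiffCovariantDerivative D ∞)
    (h : IsDualPair D D') (b c : TangentSpace I x) :
    ∃ L : TangentSpace I x →ₗ[ℝ] TangentSpace I x, ∀ a, curvature D x a b c = L a := by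
  refine ⟨(TensorialAt.mkHom _ x (tensorialAt_curvField (Y := globalExt b) hD
    (smoothField_globalExt c)) : TangentSpace I x →L[ℝ] TangentSpace I x), fun a ↦ ?_⟩
  have := TensorialAt.mkHom_apply (tensorialAt_curvField (x := x) (Y := globalExt b) hD
    (smoothField_globalExt c)) (smoothField_globalExt a).mdiffAt
  rw [globalExt_self] at this
  rw [curvature_eq_curvField h.smooth_left]
  exact this.symm

/-- The second Bianchi identity. -/
lemma IsDualPair.bianchi_second (h : IsDualPair D D')
    {R : Π y : M, TangentSpace I y → TangentSpace I y → TangentSpace I y → TangentSpace I y}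
    (hR : ∀ {X Y Z : Π y : M, TangentSpace I y} {y : M}, SmoothField X → SmoothField Y →
      SmoothField Z → R y (X y) (Y y) (Z y) = curvField D X Y Z y)
    (hsub : ∀ a a' b c : TangentSpace I x, R x (a - a') b c = R x a b c - R x a' b c)
    (hswap : ∀ a b c : TangentSpace I x, R x a b c = - R x b a c)
    (v a b c : TangentSpace I x) :
    nablaThree D R x v a b c + nablaThree D R x a b v c + nablaThree D R x b v a c = 0 := by
  have hA {X Y Z : Π y : M, TangentSpace I y} (hX : SmoothField X) (hY : SmoothField Y)
      (hZ : SmoothField Z) : SmoothField (fun y ↦ R y (X y) (Y y) (Z y)) := by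
    rw [show (fun y ↦ R y (X y) (Y y) (Z y)) = curvField D X Y Z from funext fun y ↦ hR hX hY hZ]
    exact h.curvField_smooth hX hY hZ
  have s (v : TangentSpace I x) := smoothField_globalExt v
  generalize hW : globalExt c = W
  have hWs : SmoothField W := hW ▸ s c
  have key (v a b : TangentSpace I x) : nablaThree D R x v a b c =
      nabla D (globalExt v) (curvField D (globalExt a) (globalExt b) W) x
        - R x (nabla D (globalExt v) (globalExt a) x) b c
        + R x (nabla D (globalExt v) (globalExt b) x) a c
        - curvField D (globalExt a) (globalExt b) (nabla D (globalExt v) W) x := by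
    rw [nablaThree_eq hA, hswap a, ← hR (s a) (s b) (h.smooth_left (s v) hWs)]
    rw [show (fun y ↦ R y (globalExt a y) (globalExt b y) (globalExt c y)) =
      curvField D (globalExt a) (globalExt b) W from funext fun y ↦ by rw [hW, hR (s a) (s b) hWs]]
    simp [nabla, hW]
  -- Torsion-freeness collects the correction terms of the three cyclic summands in pairs, each
  -- giving the curvature along a bracket. The remaining second derivatives along brackets then
  -- cancel, and the Jacobi identity removes the double brackets.
  have sw {v a : TangentSpace I x} (b : TangentSpace I x) : R x (nabla D (globalExt v) (globalExt a) x) b c -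
      R x (nabla D (globalExt a) (globalExt v) x) b c =
        curvField D (mlieBracket I (globalExt v) (globalExt a)) (globalExt b) W x := by
    rw [← hsub, ← hR ((s v).bracket (s a)) (s b) hWs,
      ← nabla_sub_nabla_swap h.torsion_left (s v) (s a)]
    simp [← hW]
  rw [key, key, key]
  have e1 := sw (v := v) (a := a) b
  have e2 := sw (v := a) (a := b) v
  have e3 := sw (v := b) (a := v) a
  have hj := jacobi_cyclic (s v) (s a) (s b)
  have hx {X Y Z : Π y : M, TangentSpace I y} (hX : SmoothField X) (hY : SmoothField Y)
      (hZ : SmoothField Z) : nabla D X (curvField D Y Z W) x =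
        nabla D X (nabla D Y (nabla D Z W)) x - nabla D X (nabla D Z (nabla D Y W)) x
          - nabla D X (nabla D (mlieBracket I Y Z) W) x := by
    have s1 := h.smooth_left hY (h.smooth_left hZ hWs)
    have s2 := h.smooth_left hZ (h.smooth_left hY hWs)
    rw [curvField, nabla_sub_right (s1.sub s2) (h.smooth_left (hY.bracket hZ) hWs),
      nabla_sub_right s1 s2]
    rfl
  have hb {X Y : Π y : M, TangentSpace I y} :
      nabla D (mlieBracket I X Y) W x = - nabla D (mlieBracket I Y X) W x := by
    rw [VectorField.mlieBracket_swap, nabla_neg_left, Pi.neg_apply]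
  replace hj := congrArg (fun X ↦ nabla D X W x) hj
  simp only [nabla_add_left, nabla_zero_left, Pi.add_apply, Pi.zero_apply] at hj
  simp only [curvField, Pi.sub_apply] at e1 e2 e3
  rw [hb (Y := globalExt b)] at e1
  rw [hb (Y := globalExt v)] at e2
  rw [hb (Y := globalExt a)] at e3
  rw [hx (s v) (s a) (s b), hx (s a) (s b) (s v), hx (s b) (s v) (s a)]
  simp only [curvField, Pi.sub_apply]
  linear_combination (norm := module) (-1 : ℝ) • e1 - e2 - e3 - hj

variable [IsContMDiffRiemannianBundle I ∞ E (fun x : M ↦ TangentSpace I x)]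

namespace IsDualPair

/-- Duality moves the curvature onto the other factor, leaving `Z` undifferentiated, so only its
value at `x` matters. -/
lemma curvField_congr_right (h : IsDualPair D D') (hX : SmoothField X) (hY : SmoothField Y)
    (hZ : SmoothField Z) (hZ' : SmoothField Z') (hx : Z x = Z' x) :
    curvField D X Y Z x = curvField D X Y Z' x := by
  refine ext_inner_right ℝ fun w ↦ ?_
  have h1 := h.inner_curvField (x := x) hX hY hZ (smoothField_globalExt w)
  have h2 := h.inner_curvField (x := x) hX hY hZ' (smoothField_globalExt w)
  rw [globalExt_self] at h1 h2
  rw [h1, h2, hx]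

/-- The curvature is a tensor. -/
lemma curvature_apply (h : IsDualPair D D')
    (hD : CovariantDerivative.ContMDiffCovariantDerivative D ∞) (hX : SmoothField X)
    (hY : SmoothField Y) (hZ : SmoothField Z) :
    curvature D x (X x) (Y x) (Z x) = curvField D X Y Z x := by
  have s (v : TangentSpace I x) := smoothField_globalExt v
  have p {X X' Y Z} (hX : SmoothField (I := I) (M := M) X) (hX' : SmoothField (I := I) (M := M) X')
      (hY : SmoothField (I := I) (M := M) Y) (hZ : SmoothField (I := I) (M := M) Z)
      (e : X x = X' x) : curvField D X Y Z x = curvField D X' Y Z x :=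
    (tensorialAt_curvField hD hZ).pointwise hX.mdiffAt hX'.mdiffAt e
  rw [curvature_eq_curvField h.smooth_left,
    h.curvField_congr_right (s _) (s _) (s _) hZ (globalExt_self _),
    p (s _) hX (s _) hZ (globalExt_self _), curvField_swap, Pi.neg_apply,
    p (s _) hY hX hZ (globalExt_self _), ← Pi.neg_apply, ← curvField_swap]

lemma inner_curvature (h : IsDualPair D D') (a b c d : TangentSpace I x) :
    inner ℝ (curvature D x a b c) d = - inner ℝ c (curvature D' x a b d) := by
  have := h.inner_curvField (x := x) (smoothField_globalExt a) (smoothField_globalExt b)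
    (smoothField_globalExt c) (smoothField_globalExt d)
  rwa [globalExt_self, globalExt_self, ← curvature_eq_curvField h.smooth_left,
    ← curvature_eq_curvField h.smooth_right] at this

lemma curvature_bianchi (h : IsDualPair D D')
    (hD : CovariantDerivative.ContMDiffCovariantDerivative D ∞) (a b c : TangentSpace I x) :
    curvature D x a b c + curvature D x b c a + curvature D x c a b = 0 := by
  have s (v : TangentSpace I x) := smoothField_globalExt v
  have := congrFun (h.bianchi_first (s a) (s b) (s c)) x
  simpa [← h.curvature_apply hD (s _) (s _) (s _)] using this

end IsDualPair

end CurvatureTensor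

/-- The algebraic core: `r` is a curvature-like form, `H` its metric covariant derivative, and
`N`, `N'` its covariant derivatives for two connections that differ from the metric one by `K`, `-K`. -/
lemma curvature_identity {T : Type*} {r : T → T → T → T → ℝ} {H N N' : T → T → T → T → T → ℝ}
    {K : T → T → T} (hK : ∀ a b, K a b = K b a)
    (hN : ∀ v a b c d, N v a b c d = H v a b c d +
      (r a b c (K v d) - r (K v a) b c d - r a (K v b) c d - r a b (K v c) d))
    (hN' : ∀ v a b c d, N' v a b c d = H v a b c d -
      (r a b c (K v d) - r (K v a) b c d - r a (K v b) c d - r a b (K v c) d))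
    (bN : ∀ v a b c d, N v a b c d + N a b v c d + N b v a c d = 0)
    (bN' : ∀ v a b c d, N' v a b c d + N' a b v c d + N' b v a c d = 0)
    (r1 : ∀ a b c d, r a b c d = - r b a c d) (r2 : ∀ a b c d, r a b c d = - r a b d c)
    (r3 : ∀ a b c d, r a b c d = r c d a b)
    (r4 : ∀ a b c d, r a b c d + r b c a d + r c a b d = 0)
    (h2 : ∀ v a b c d, H v a b c d = - H v a b d c)
    (h3 : ∀ v a b c d, H v a b c d = H v c d a b) (V t f : T) :
    N' f V f t V + N' V t f f V - H t V f f V - 2 * r V f (K f t) V + 2 * r f t (K f V) V = 0 := by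
  have h1 (v a b c d) : H v a b c d = - H v b a c d := by rw [h3, h2, h3 v c]
  -- Adding the two Bianchi identities cancels all `K`-terms, since they enter with opposite signs.
  have bH : H f t V V f + H t V f V f + H V f t V f = 0 := by
    linarith [bN f t V V f, bN' f t V V f, hN f t V V f, hN t V f V f, hN V f t V f,
      hN' f t V V f, hN' t V f V f, hN' V f t V f]
  -- Given `bH`, this Bianchi identity is a relation among `K`-terms alone. Symmetry of `K` leaves
  -- five vectors, named below; the goal is then linear in values of `r` and `H`, and the listed
  -- facts are the symmetry instances that match them.
  have bK := bN f t V V f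
  rw [hN, hN, hN] at bK
  rw [hN', hN']
  rw [hK V f, hK V t] at *
  rw [hK t f] at bK
  generalize K f V = A at *
  generalize K f t = B at *
  generalize K t V = C at *
  generalize K V V = G at *
  generalize K f f = P at *
  linarith [h3 f V f t V, h1 V t f f V, h2 V f t f V, h2 t V f f V, r3 V P t V, r3 A f t V,
    r2 V f B V, r2 C f f V, r3 C f V f, r1 t f A V, r2 f t A V, r1 t f f G, r2 f t f G,
    r3 t A f V, r1 f V t A, r4 V f t A, r2 t V f A, r1 B V V f, r1 t A V f, r1 C f V f]

/-! ### Conjugate symmetric structures -/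

section ConjugateSymmetric

open scoped Topology

variable {E : Type*} [NormedAddCommGroup E] [NormedSpace ℝ E] [FiniteDimensional ℝ E]
  {H : Type*} [TopologicalSpace H] {I : ModelWithCorners ℝ E H}
  {M : Type*} [TopologicalSpace M] [ChartedSpace H M] [IsManifold I ∞ M]
  {D D' : CovariantDerivative I E (TangentSpace I : M → Type _)}
  {X Y Z : Π y : M, TangentSpace I y} {x : M}
  [RiemannianBundle (fun x : M ↦ TangentSpace I x)] [T2Space M]
  [IsContMDiffRiemannianBundle I ∞ E (fun x : M ↦ TangentSpace I x)]

section Difference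

set_option linter.unusedSectionVars false in
lemma cov_eq_add_differenceTensor (hY : MDiffAt (T% Y) x) (v : TangentSpace I x) :
    D Y x v = leviCivita I M Y x v + differenceTensor D x v (Y x) := by
  have := IsCovariantDerivativeOn.difference_apply D.isCovariantDerivativeOnUniv
    (leviCivita I M).isCovariantDerivativeOnUniv (x := x) (σ := Y) trivial hY
  rw [differenceTensor, CovariantDerivative.difference, this]
  simp

lemma IsDualPair.cov_eq_sub_differenceTensor (h : IsDualPair D D') (hY : MDiffAt (T% Y) x)
    (v : TangentSpace I x) :
    D' Y x v = leviCivita I M Y x v - differenceTensor D x v (Y x) := by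
  have h1 := cov_eq_add_differenceTensor (D := D) hY v
  have h2 := h.leviCivita_apply hY v
  linear_combination (norm := module) (-1 : ℝ) • h1 - (2 : ℝ) • h2

lemma IsDualPair.differenceTensor_comm (h : IsDualPair D D') (v w : TangentSpace I x) :
    differenceTensor D x v w = differenceTensor D x w v := by
  have hv := smoothField_globalExt v
  have hw := smoothField_globalExt w
  have h1 := D.torsion_eq_zero_iff.1 h.torsion_left (x := x) hv.mdiffAt hw.mdiffAt
  have h2 := (leviCivita I M).torsion_eq_zero_iff.1 h.isDualPair_leviCivita.torsion_left (x := x)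
    hv.mdiffAt hw.mdiffAt
  rw [cov_eq_add_differenceTensor hw.mdiffAt, cov_eq_add_differenceTensor hv.mdiffAt, ← h2] at h1
  simp only [globalExt_self] at h1
  linear_combination (norm := module) h1

/-- Compare the duality of `∇^h + K` and `∇^h - K` with the metric property of `∇^h`. -/
lemma IsDualPair.inner_differenceTensor (h : IsDualPair D D') (v a b : TangentSpace I x) :
    inner ℝ (differenceTensor D x v a) b = inner ℝ a (differenceTensor D x v b) := by
  have ha := smoothField_globalExt a
  have hb := smoothField_globalExt b
  have h1 := h.dual (x := x) v ha.mdiffAt hb.mdiffAt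
  rw [h.isDualPair_leviCivita.dual (x := x) v ha.mdiffAt hb.mdiffAt,
    cov_eq_add_differenceTensor (D := D) ha.mdiffAt,
    h.cov_eq_sub_differenceTensor hb.mdiffAt] at h1
  simp only [globalExt_self, inner_add_left, inner_sub_right] at h1
  linarith

end Difference

namespace IsDualPair

set_option linter.unusedSectionVars false in
lemma curvature_smul_add_left (hD : CovariantDerivative.ContMDiffCovariantDerivative D ∞)
    (h : IsDualPair D D') (t : ℝ) (a a' b c : TangentSpace I x) :
    curvature D x (t • a + a') b c = t • curvature D x a b c + curvature D x a' b c := by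
  obtain ⟨L, hL⟩ := exists_curvature_linear hD h b c
  simp [hL]

lemma curvature_smul_add_mid (hD : CovariantDerivative.ContMDiffCovariantDerivative D ∞)
    (h : IsDualPair D D') (t : ℝ) (a b b' c : TangentSpace I x) :
    curvature D x a (t • b + b') c = t • curvature D x a b c + curvature D x a b' c := by
  rw [h.curvature_swap, h.curvature_smul_add_left hD, h.curvature_swap a b, h.curvature_swap a b']
  module

/-- By duality the third slot becomes a bare factor of an inner product. -/
lemma curvature_smul_add_right (h : IsDualPair D D') (t : ℝ) (a b c c' : TangentSpace I x) :
    curvature D x a b (t • c + c') = t • curvature D x a b c + curvature D x a b c' := by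
  refine ext_inner_right ℝ fun d ↦ ?_
  rw [h.inner_curvature, inner_add_left, inner_add_left, real_inner_smul_left,
    real_inner_smul_left, h.inner_curvature a b c, h.inner_curvature a b c']
  ring

set_option linter.unusedSectionVars false in
lemma inner_interchange (hD : CovariantDerivative.ContMDiffCovariantDerivative D ∞)
    (h : IsDualPair D D') (a b c d : TangentSpace I x) :
    inner ℝ (interchange D x a b c) d = inner ℝ (curvature D x c d a) b := by
  obtain ⟨L, hL⟩ := exists_curvature_linear hD h c a
  have hL' (w) : curvature D x c w a = - L w := by rw [h.curvature_swap, hL]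
  conv_rhs => rw [← (onb I x).sum_repr' d, hL', map_sum, inner_neg_left, sum_inner]
  simp only [interchange, hL', sum_inner, real_inner_smul_left, map_smul, inner_neg_left]
  rw [← Finset.sum_neg_distrib]
  exact Finset.sum_congr rfl fun i _ ↦ by ring

end IsDualPair

namespace IsStatistical

lemma inner_curvature_pair (h : IsStatistical D) (hs : IsConjugateSymmetric D)
    (a b c d : TangentSpace I x) :
    inner ℝ (curvature D x a b c) d = inner ℝ (curvature D x c d a) b := by
  rw [hs, h.isDualPair.inner_interchange h.smooth]

lemma inner_curvature_skew (h : IsStatistical D) (hs : IsConjugateSymmetric D)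
    (a b c d : TangentSpace I x) :
    inner ℝ (curvature D x a b c) d = - inner ℝ (curvature D x a b d) c := by
  rw [h.inner_curvature_pair hs, h.isDualPair.curvature_swap, inner_neg_left,
    h.inner_curvature_pair hs]

/-- Duality always makes `Rbar` minus the adjoint of `R`; under conjugate symmetry `R(a, b)` is
skew-adjoint. -/
lemma curvature_conjugate (h : IsStatistical D) (hs : IsConjugateSymmetric D) :
    curvature (conjugate D) = curvature D := by
  funext x a b c
  refine ext_inner_right ℝ fun d ↦ ?_
  rw [h.isDualPair.symm.inner_curvature, real_inner_comm, h.inner_curvature_skew hs, neg_neg]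

lemma interchange_conjugate (h : IsStatistical D) (hs : IsConjugateSymmetric D) :
    interchange (conjugate D) = curvature D := by
  funext x a b c
  rw [hs x a b c, interchange, interchange, h.curvature_conjugate hs]

/-- Tensoriality for the conjugate connection is inherited from that of `D` through duality. It lets
the second Bianchi identity of the conjugate connection be applied to the tensor `curvature D`. -/
lemma curvature_conjugate_apply (h : IsStatistical D) (hs : IsConjugateSymmetric D)
    (hX : SmoothField X) (hY : SmoothField Y) (hZ : SmoothField Z) :
    curvature D x (X x) (Y x) (Z x) = curvField (conjugate D) X Y Z x := by
  refine ext_inner_right ℝ fun d ↦ ?_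
  have := h.isDualPair.symm.inner_curvField (x := x) hX hY hZ (smoothField_globalExt d)
  rw [globalExt_self] at this
  rw [this, ← h.isDualPair.curvature_apply h.smooth hX hY (smoothField_globalExt d),
    globalExt_self, h.inner_curvature_skew hs (X x) (Y x) (Z x) d, real_inner_comm]

lemma smoothField_curvature (h : IsStatistical D) (hX : SmoothField X) (hY : SmoothField Y)
    (hZ : SmoothField Z) : SmoothField (fun y ↦ curvature D y (X y) (Y y) (Z y)) := by
  rw [show (fun y ↦ curvature D y (X y) (Y y) (Z y)) = curvField D X Y Z from
    funext fun y ↦ h.isDualPair.curvature_apply h.smooth hX hY hZ]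
  exact h.isDualPair.curvField_smooth hX hY hZ

lemma curvature_add_left (h : IsStatistical D) (a a' b c : TangentSpace I x) :
    curvature D x (a + a') b c = curvature D x a b c + curvature D x a' b c := by
  simpa using h.isDualPair.curvature_smul_add_left h.smooth 1 a a' b c

lemma curvature_add_mid (h : IsStatistical D) (a b b' c : TangentSpace I x) :
    curvature D x a (b + b') c = curvature D x a b c + curvature D x a b' c := by
  simpa using h.isDualPair.curvature_smul_add_mid h.smooth 1 a b b' c

lemma curvature_add_right (h : IsStatistical D) (a b c c' : TangentSpace I x) :
    curvature D x a b (c + c') = curvature D x a b c + curvature D x a b c' := by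
  simpa using h.isDualPair.curvature_smul_add_right 1 a b c c'

lemma curvature_sub_left (h : IsStatistical D) (a a' b c : TangentSpace I x) :
    curvature D x (a - a') b c = curvature D x a b c - curvature D x a' b c := by
  rw [eq_sub_iff_add_eq, ← h.curvature_add_left, sub_add_cancel]

lemma curvature_sub_mid (h : IsStatistical D) (a b b' c : TangentSpace I x) :
    curvature D x a (b - b') c = curvature D x a b c - curvature D x a b' c := by
  rw [eq_sub_iff_add_eq, ← h.curvature_add_mid, sub_add_cancel]

lemma curvature_sub_right (h : IsStatistical D) (a b c c' : TangentSpace I x) :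
    curvature D x a b (c - c') = curvature D x a b c - curvature D x a b c' := by
  rw [eq_sub_iff_add_eq, ← h.curvature_add_right, sub_add_cancel]

/-- The two connections differ by `K(v, ·)`, which acts on tensors as a derivation. -/
lemma nablaThree_curvature (h : IsStatistical D) (v a b c : TangentSpace I x) :
    nablaThree D (curvature D) x v a b c =
      nablaThree (leviCivita I M) (curvature D) x v a b c +
        (differenceTensor D x v (curvature D x a b c)
          - curvature D x (differenceTensor D x v a) b c
          - curvature D x a (differenceTensor D x v b) c
          - curvature D x a b (differenceTensor D x v c)) := by
  have s (v : TangentSpace I x) := smoothField_globalExt v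
  rw [nablaThree_eq h.smoothField_curvature, nablaThree_eq h.smoothField_curvature,
    cov_eq_add_differenceTensor (h.smoothField_curvature (s a) (s b) (s c)).mdiffAt,
    cov_eq_add_differenceTensor (s a).mdiffAt, cov_eq_add_differenceTensor (s b).mdiffAt,
    cov_eq_add_differenceTensor (s c).mdiffAt, h.curvature_add_left, h.curvature_add_mid,
    h.curvature_add_right]
  simp only [globalExt_self]
  abel

lemma nablaThree_conjugate_curvature (h : IsStatistical D) (v a b c : TangentSpace I x) :
    nablaThree (conjugate D) (curvature D) x v a b c =
      nablaThree (leviCivita I M) (curvature D) x v a b c -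
        (differenceTensor D x v (curvature D x a b c)
          - curvature D x (differenceTensor D x v a) b c
          - curvature D x a (differenceTensor D x v b) c
          - curvature D x a b (differenceTensor D x v c)) := by
  have s (v : TangentSpace I x) := smoothField_globalExt v
  have k {Y : Π y : M, TangentSpace I y} (hY : SmoothField Y) :=
    h.isDualPair.cov_eq_sub_differenceTensor (x := x) hY.mdiffAt
  rw [nablaThree_eq h.smoothField_curvature, nablaThree_eq h.smoothField_curvature,
    k (h.smoothField_curvature (s a) (s b) (s c)), k (s a), k (s b), k (s c),
    h.curvature_sub_left, h.curvature_sub_mid, h.curvature_sub_right]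
  simp only [globalExt_self]
  abel

/-- Because `∇^h` is metric, `∇^h R` becomes the derivative of a scalar function with corrections in
all four slots. Symmetries of `R` as a four-linear form thus pass to `∇^h R`. -/
lemma inner_nablaThree_leviCivita (h : IsStatistical D) (v a b c d : TangentSpace I x) :
    inner ℝ (nablaThree (leviCivita I M) (curvature D) x v a b c) d =
      d% (fun y ↦ (inner ℝ (curvature D y (globalExt a y) (globalExt b y) (globalExt c y))
        (globalExt d y) : ℝ)) x v
        - inner ℝ (curvature D x (leviCivita I M (globalExt a) x v) b c) d
        - inner ℝ (curvature D x a (leviCivita I M (globalExt b) x v) c) d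
        - inner ℝ (curvature D x a b (leviCivita I M (globalExt c) x v)) d
        - inner ℝ (curvature D x a b c) (leviCivita I M (globalExt d) x v) := by
  have s (v : TangentSpace I x) := smoothField_globalExt v
  rw [nablaThree_eq h.smoothField_curvature, h.isDualPair.isDualPair_leviCivita.dual v
    (h.smoothField_curvature (s a) (s b) (s c)).mdiffAt (s d).mdiffAt]
  simp only [inner_sub_left, globalExt_self]
  ring

lemma inner_nablaThree_leviCivita_skew (h : IsStatistical D) (hs : IsConjugateSymmetric D)
    (v a b c d : TangentSpace I x) :
    inner ℝ (nablaThree (leviCivita I M) (curvature D) x v a b c) d =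
      - inner ℝ (nablaThree (leviCivita I M) (curvature D) x v a b d) c := by
  rw [h.inner_nablaThree_leviCivita, h.inner_nablaThree_leviCivita]
  simp only [h.inner_curvature_skew hs _ _ (globalExt c _), h.inner_curvature_skew hs _ _ c,
    h.inner_curvature_skew hs a b (leviCivita I M (globalExt c) x v)]
  rw [mvfderiv_fun_neg, _root_.neg_apply]
  ring

lemma inner_nablaThree_leviCivita_pair (h : IsStatistical D) (hs : IsConjugateSymmetric D)
    (v a b c d : TangentSpace I x) :
    inner ℝ (nablaThree (leviCivita I M) (curvature D) x v a b c) d =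
      inner ℝ (nablaThree (leviCivita I M) (curvature D) x v c d a) b := by
  rw [h.inner_nablaThree_leviCivita, h.inner_nablaThree_leviCivita]
  simp only [h.inner_curvature_pair hs (globalExt a _), h.inner_curvature_pair hs a,
    h.inner_curvature_pair hs (leviCivita I M (globalExt a) x v)]
  ring

/-- The pointwise identity behind the reduction of the operator `H_u`. -/
lemma conjugateSymmetric_identity (h : IsStatistical D) (hs : IsConjugateSymmetric D)
    (V t f : TangentSpace I x) :
    inner ℝ (nablaThree (conjugate D) (curvature D) x f V f t) V
      + inner ℝ (nablaThree (conjugate D) (curvature D) x V t f f) V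
      - inner ℝ (nablaThree (leviCivita I M) (curvature D) x t V f f) V
      - 2 * inner ℝ (curvature D x V f (differenceTensor D x f t)) V
      + 2 * inner ℝ (curvature D x f t (differenceTensor D x f V)) V = 0 := by
  have hd := h.isDualPair
  refine curvature_identity (r := fun a b c d ↦ inner ℝ (curvature D x a b c) d)
    (H := fun v a b c d ↦ inner ℝ (nablaThree (leviCivita I M) (curvature D) x v a b c) d)
    (N := fun v a b c d ↦ inner ℝ (nablaThree D (curvature D) x v a b c) d)
    (N' := fun v a b c d ↦ inner ℝ (nablaThree (conjugate D) (curvature D) x v a b c) d)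
    (K := differenceTensor D x) hd.differenceTensor_comm ?_ ?_ ?_ ?_ ?_
    (h.inner_curvature_skew hs) (h.inner_curvature_pair hs) ?_
    (h.inner_nablaThree_leviCivita_skew hs) (h.inner_nablaThree_leviCivita_pair hs) V t f
  · intro v a b c d
    simp only [h.nablaThree_curvature, inner_add_left, inner_sub_left, hd.inner_differenceTensor]
  · intro v a b c d
    simp only [h.nablaThree_conjugate_curvature, inner_sub_left, hd.inner_differenceTensor]
  · intro v a b c d
    rw [← inner_add_left, ← inner_add_left, hd.bianchi_second (R := curvature D)
      (hd.curvature_apply h.smooth) h.curvature_sub_left hd.curvature_swap, inner_zero_left]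
  · intro v a b c d
    rw [← inner_add_left, ← inner_add_left, hd.symm.bianchi_second (R := curvature D)
      (h.curvature_conjugate_apply hs) h.curvature_sub_left hd.curvature_swap, inner_zero_left]
  · intro a b c d
    rw [hd.curvature_swap, inner_neg_left]
  · intro a b c d
    rw [← inner_add_left, ← inner_add_left, hd.curvature_bianchi h.smooth, inner_zero_left]

end IsStatistical

end ConjugateSymmetric

/-! ### Linearity of covariant derivatives of tensors in their arguments -/

section Linearity

open scoped Topology

variable {E : Type*} [NormedAddCommGroup E] [NormedSpace ℝ E]
  {H : Type*} [TopologicalSpace H] {I : ModelWithCorners ℝ E H}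
  {M : Type*} [TopologicalSpace M] [ChartedSpace H M] [IsManifold I ∞ M]
  {D : CovariantDerivative I E (TangentSpace I : M → Type _)}
  {X Y : Π y : M, TangentSpace I y} {x : M}

lemma cov_smul_add (t : ℝ) (hX : SmoothField X) (hY : SmoothField Y) (v : TangentSpace I x) :
    D (t • X + Y) x v = t • D X x v + D Y x v := by
  rw [D.isCovariantDerivativeOn.add (s := Set.univ) (hX.const_smul t).mdiffAt hY.mdiffAt,
    D.isCovariantDerivativeOn.smul_const (s := Set.univ) t hX.mdiffAt]
  rfl

/-- Extensions are constant in the trivialization around `x`, which is linear on fibres over its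
base set. -/
lemma ext_smul_add (t : ℝ) (v w : TangentSpace I x) :
    ∀ᶠ y in 𝓝 x, ext (t • v + w) y = t • ext v y + ext w y := by
  have hx := FiberBundle.mem_baseSet_trivializationAt' (F := E) (E := TangentSpace I (M := M)) x
  filter_upwards [(trivializationAt E (TangentSpace I : M → Type _) x).open_baseSet.mem_nhds hx]
    with y hy
  have h := (trivializationAt E (TangentSpace I : M → Type _) x).linear ℝ hx
  simp only [ext, extend, h.map_add, h.map_smul]
  rw [← Trivialization.coe_symmₗ (R := ℝ) _ hy, map_add, map_smul]

variable [FiniteDimensional ℝ E] [T2Space M]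

lemma globalExt_smul_add (t : ℝ) (v w : TangentSpace I x) :
    ∀ᶠ y in 𝓝 x, globalExt (t • v + w) y = t • globalExt v y + globalExt w y := by
  filter_upwards [ext_smul_add t v w, globalExt_eventuallyEq v, globalExt_eventuallyEq w,
    globalExt_eventuallyEq (t • v + w)] with y h1 h2 h3 h4
  rw [h4, h1, h2, h3]

lemma cov_globalExt_smul_add (t : ℝ) (a b v : TangentSpace I x) :
    D (globalExt (t • a + b)) x v = t • D (globalExt a) x v + D (globalExt b) x v := by
  rw [cov_congr (smoothField_globalExt _).mdiffAt (globalExt_smul_add t a b)]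
  exact cov_smul_add t (smoothField_globalExt a) (smoothField_globalExt b) v

section

variable {A : Π y : M, TangentSpace I y → TangentSpace I y → TangentSpace I y → TangentSpace I y}

lemma nablaThree_smul_add_mid
    (hA : ∀ {X Y Z : Π y : M, TangentSpace I y}, SmoothField X → SmoothField Y → SmoothField Z →
      SmoothField (fun y ↦ A y (X y) (Y y) (Z y)))
    (hmid : ∀ (y : M) (t : ℝ) (a b b' c : TangentSpace I y),
      A y a (t • b + b') c = t • A y a b c + A y a b' c)
    (t : ℝ) (v a b b' c : TangentSpace I x) :
    nablaThree D A x v a (t • b + b') c =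
      t • nablaThree D A x v a b c + nablaThree D A x v a b' c := by
  have s (v : TangentSpace I x) := smoothField_globalExt v
  have e : D (fun y ↦ A y (globalExt a y) (globalExt (t • b + b') y) (globalExt c y)) x =
      D (t • (fun y ↦ A y (globalExt a y) (globalExt b y) (globalExt c y)) +
        fun y ↦ A y (globalExt a y) (globalExt b' y) (globalExt c y)) x := by
    refine cov_congr (hA (s _) (s _) (s _)).mdiffAt ?_
    filter_upwards [globalExt_smul_add t b b'] with y hy
    rw [hy, hmid]
    rfl
  rw [nablaThree_eq hA, nablaThree_eq hA, nablaThree_eq hA, e,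
    cov_smul_add t (hA (s _) (s _) (s _)) (hA (s _) (s _) (s _)), cov_globalExt_smul_add,
    hmid, hmid, hmid]
  module

lemma nablaThree_smul_add_right
    (hA : ∀ {X Y Z : Π y : M, TangentSpace I y}, SmoothField X → SmoothField Y → SmoothField Z →
      SmoothField (fun y ↦ A y (X y) (Y y) (Z y)))
    (hright : ∀ (y : M) (t : ℝ) (a b c c' : TangentSpace I y),
      A y a b (t • c + c') = t • A y a b c + A y a b c')
    (t : ℝ) (v a b c c' : TangentSpace I x) :
    nablaThree D A x v a b (t • c + c') =
      t • nablaThree D A x v a b c + nablaThree D A x v a b c' := by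
  have s (v : TangentSpace I x) := smoothField_globalExt v
  have e : D (fun y ↦ A y (globalExt a y) (globalExt b y) (globalExt (t • c + c') y)) x =
      D (t • (fun y ↦ A y (globalExt a y) (globalExt b y) (globalExt c y)) +
        fun y ↦ A y (globalExt a y) (globalExt b y) (globalExt c' y)) x := by
    refine cov_congr (hA (s _) (s _) (s _)).mdiffAt ?_
    filter_upwards [globalExt_smul_add t c c'] with y hy
    rw [hy, hright]
    rfl
  rw [nablaThree_eq hA, nablaThree_eq hA, nablaThree_eq hA, e,
    cov_smul_add t (hA (s _) (s _) (s _)) (hA (s _) (s _) (s _)), cov_globalExt_smul_add,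
    hright, hright, hright]
  module

end

end Linearity

/-- The trace of a bilinear form does not depend on the orthonormal basis. -/
lemma sum_onb_eq {T ι κ : Type*} [Fintype ι] [Fintype κ] [NormedAddCommGroup T]
    [InnerProductSpace ℝ T] (b : OrthonormalBasis ι ℝ T) (e : OrthonormalBasis κ ℝ T)
    (B : T → T → ℝ) (hl : ∀ (t : ℝ) a a' c, B (t • a + a') c = t * B a c + B a' c)
    (hr : ∀ (t : ℝ) a c c', B a (t • c + c') = t * B a c + B a c') :
    ∑ i, B (b i) (b i) = ∑ j, B (e j) (e j) := by
  have l0 (c) : B 0 c = 0 := by simpa using hl 1 0 0 c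
  have r0 (a) : B a 0 = 0 := by simpa using hr 1 a 0 0
  let L : T →ₗ[ℝ] T →ₗ[ℝ] ℝ := LinearMap.mk₂ ℝ B
    (fun a a' c ↦ by simpa using hl 1 a a' c) (fun t a c ↦ by simpa [l0] using hl t a 0 c)
    (fun a c c' ↦ by simpa using hr 1 a c c') (fun t a c ↦ by simpa [r0] using hr t a c 0)
  have hL (a c) : B a c = L a c := rfl
  have key (i : κ) : L (e i) (e i) =
      ∑ j, ∑ k, inner ℝ (b j) (e i) * inner ℝ (e i) (b k) * L (b j) (b k) := by
    conv_lhs => rw [← b.sum_repr' (e i)]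
    simp only [map_sum, LinearMap.sum_apply, map_smul, LinearMap.smul_apply, smul_eq_mul,
      Finset.mul_sum]
    rw [Finset.sum_comm]
    refine Finset.sum_congr rfl fun j _ ↦ Finset.sum_congr rfl fun k _ ↦ ?_
    rw [real_inner_comm (e i) (b k)]
    ring
  simp only [hL, key]
  rw [Finset.sum_comm]
  refine Finset.sum_congr rfl fun j _ ↦ ?_
  rw [Finset.sum_comm]
  simp only [← Finset.sum_mul, e.sum_inner_mul_inner]
  classical
  simp [orthonormal_iff_ite.1 b.orthonormal]

/-! ### Reduction of `H_u` and independence of the frame -/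

section Maps

variable {E : Type*} [NormedAddCommGroup E] [NormedSpace ℝ E] [FiniteDimensional ℝ E]
  {H : Type*} [TopologicalSpace H] {I : ModelWithCorners ℝ E H}
  {M : Type*} [TopologicalSpace M] [ChartedSpace H M] [IsManifold I ∞ M]
  {E' : Type*} [NormedAddCommGroup E'] [NormedSpace ℝ E'] [FiniteDimensional ℝ E']
  {H' : Type*} [TopologicalSpace H'] {J : ModelWithCorners ℝ E' H'}
  {N : Type*} [TopologicalSpace N] [ChartedSpace H' N] [IsManifold J ∞ N] [T2Space N]
  [RiemannianBundle (fun x : M ↦ TangentSpace I x)]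
  [IsContMDiffRiemannianBundle I ∞ E (fun x : M ↦ TangentSpace I x)]
  [RiemannianBundle (fun x : N ↦ TangentSpace J x)]
  [IsContMDiffRiemannianBundle J ∞ E' (fun x : N ↦ TangentSpace J x)]
  {DM : CovariantDerivative I E (TangentSpace I : M → Type _)}
  {DN DN' : CovariantDerivative J E' (TangentSpace J : N → Type _)}
  {u : M → N} {x : M}

set_option linter.unusedSectionVars false in
lemma IsDualPair.pullbackConn_eq (h : IsDualPair DN DN') (U : Π x : M, TangentSpace J (u x))
    (v : TangentSpace I x) :
    pullbackConn DN' u U x v = pullbackConn (leviCivita J N) u U x v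
      - differenceTensor DN (u x) (mfderiv I J u x v) (U x) := by
  have := h.cov_eq_sub_differenceTensor (mdifferentiableAt_extend J E' (U x))
    (mfderiv I J u x v)
  rw [extend_apply_self] at this
  simp only [pullbackConn, _root_.add_apply, ContinuousLinearMap.comp_apply]
  rw [this]
  abel

lemma IsStatistical.inner_hOp (h : IsStatistical DN) (hs : IsConjugateSymmetric DN)
    (V : Π x : M, TangentSpace J (u x)) {ι : Type*} [Fintype ι]
    (e : OrthonormalBasis ι ℝ (TangentSpace I x)) :
    inner ℝ (hOp DM DN u V x) (V x) = inner ℝ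
      (curvature DN (u x) (V x) (tension (conjugate DM) (conjugate DN) u x) (tension DM DN u x)
        + (2 : ℝ) • ∑ i, curvature DN (u x) (V x) (mfderiv I J u x (e i))
            (pullbackConn (leviCivita J N) u (tension DM DN u) x (e i))
        + ∑ i, nablaThree (leviCivita J N) (curvature DN) (u x) (tension DM DN u x) (V x)
            (mfderiv I J u x (e i)) (mfderiv I J u x (e i))
        - (2 : ℝ) • ∑ i, curvature DN (u x) (mfderiv I J u x (e i)) (tension DM DN u x)
            (pullbackConn (leviCivita J N) u V x (e i))
        - nablaTwo (conjugate DN) (differenceTensor DN) (u x) (V x) (tension DM DN u x)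
            (tension DM DN u x))
      (V x) := by
  have hL : interchange DN = curvature DN := by
    funext y a b c
    exact (hs y a b c).symm
  have hd := h.isDualPair
  rw [hOp, h.curvature_conjugate hs, h.interchange_conjugate hs, hL]
  generalize tension DM DN u = τ
  generalize tension (conjugate DM) (conjugate DN) u = τ'
  -- Each frame vector occurs twice in every summand. Giving the two occurrences separate arguments
  -- turns the sum into the trace of a bilinear form.
  let q (a c : TangentSpace I x) : ℝ :=
    2 * inner ℝ (curvature DN (u x) (V x) (mfderiv I J u x a)
        (pullbackConn (leviCivita J N) u τ x c)) (V x)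
      + inner ℝ (nablaThree (leviCivita J N) (curvature DN) (u x) (τ x) (V x)
          (mfderiv I J u x a) (mfderiv I J u x c)) (V x)
      - 2 * inner ℝ (curvature DN (u x) (mfderiv I J u x a) (τ x)
          (pullbackConn (leviCivita J N) u V x c)) (V x)
  have hq : ∑ i, q (onb I x i) (onb I x i) = ∑ i, q (e i) (e i) := by
    refine sum_onb_eq _ _ q ?_ ?_
    · intro t a a' c
      simp only [q, map_add, map_smul]
      rw [hd.curvature_smul_add_mid h.smooth, hd.curvature_smul_add_left h.smooth,
        nablaThree_smul_add_mid h.smoothField_curvature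
          (fun y ↦ hd.curvature_smul_add_mid (x := y) h.smooth)]
      simp only [inner_add_left, real_inner_smul_left]
      ring
    · intro t a c c'
      simp only [q, map_add, map_smul]
      rw [hd.curvature_smul_add_right, hd.curvature_smul_add_right,
        nablaThree_smul_add_right h.smoothField_curvature
          (fun y ↦ hd.curvature_smul_add_right (x := y))]
      simp only [inner_add_left, real_inner_smul_left]
      ring
  -- Passing to the Levi-Civita induced connection produces the two curvature terms in `K(f, τ)` and
  -- `K(f, V)`. The pointwise identity absorbs them, together with both `∇bar R` terms, into `∇^h_τ
  -- R`.
  have hb (a : TangentSpace I x) :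
      inner ℝ (nablaThree (conjugate DN) (curvature DN) (u x) (mfderiv I J u x a) (V x)
          (mfderiv I J u x a) (τ x)) (V x)
        + 2 * inner ℝ (curvature DN (u x) (V x) (mfderiv I J u x a)
          (pullbackConn (conjugate DN) u τ x a)) (V x)
        + inner ℝ (nablaThree (conjugate DN) (curvature DN) (u x) (V x) (τ x)
          (mfderiv I J u x a) (mfderiv I J u x a)) (V x)
        - 2 * inner ℝ (curvature DN (u x) (mfderiv I J u x a) (τ x)
          (pullbackConn (conjugate DN) u V x a)) (V x) = q a a := by
    have := h.conjugateSymmetric_identity hs (V x) (τ x) (mfderiv I J u x a)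
    rw [hd.pullbackConn_eq, hd.pullbackConn_eq, h.curvature_sub_right, h.curvature_sub_right]
    simp only [q, inner_sub_left]
    linarith
  rw [← Finset.sum_congr rfl (fun i _ ↦ hb (onb I x i))] at hq
  simp only [q, Finset.sum_add_distrib, Finset.sum_sub_distrib, ← Finset.mul_sum] at hq
  simp only [inner_add_left, inner_sub_left, real_inner_smul_left, sum_inner]
  linarith

end Maps

end StatGeom

end

theorem mainTheorem4
    {m n : ℕ}
    {M : Type*} [TopologicalSpace M] [T2Space M] [ChartedSpace (EuclideanSpace ℝ (Fin m)) M]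
    [IsManifold (𝓡 m) ∞ M] [RiemannianBundle (fun x : M ↦ TangentSpace (𝓡 m) x)]
    [IsContMDiffRiemannianBundle (𝓡 m) ∞ (EuclideanSpace ℝ (Fin m))
      (fun x : M ↦ TangentSpace (𝓡 m) x)]
    {N : Type*} [TopologicalSpace N] [T2Space N] [ChartedSpace (EuclideanSpace ℝ (Fin n)) N]
    [IsManifold (𝓡 n) ∞ N] [RiemannianBundle (fun y : N ↦ TangentSpace (𝓡 n) y)]
    [IsContMDiffRiemannianBundle (𝓡 n) ∞ (EuclideanSpace ℝ (Fin n))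
      (fun y : N ↦ TangentSpace (𝓡 n) y)]
    (DM : CovariantDerivative (𝓡 m) (EuclideanSpace ℝ (Fin m))
      (TangentSpace (𝓡 m) : M → Type _))
    (hDM : StatGeom.IsStatistical DM)
    (DN : CovariantDerivative (𝓡 n) (EuclideanSpace ℝ (Fin n))
      (TangentSpace (𝓡 n) : N → Type _))
    (hDN : StatGeom.IsStatistical DN)
    (hsymm : StatGeom.IsConjugateSymmetric DN)
    (u : M → N) (hu : ContMDiff (𝓡 m) (𝓡 n) ∞ u)
    (V : Π x : M, TangentSpace (𝓡 n) (u x))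
    (hV : ContMDiff (𝓡 m) (𝓡 n).tangent ∞
      (fun x ↦ (⟨u x, V x⟩ : TangentBundle (𝓡 n) N)))
    (x : M) (e : OrthonormalBasis (Fin m) ℝ (TangentSpace (𝓡 m) x)) :
    let R := StatGeom.curvature DN
    let hat := StatGeom.leviCivita (𝓡 n) N
    let τ := StatGeom.tension DM DN u
    let τ' := StatGeom.tension (StatGeom.conjugate DM) (StatGeom.conjugate DN) u
    let f : Fin m → TangentSpace (𝓡 n) (u x) := fun i ↦ mfderiv (𝓡 m) (𝓡 n) u x (e i)
    inner ℝ (StatGeom.hOp DM DN u V x) (V x) =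
      inner ℝ
        (R (u x) (V x) (τ' x) (τ x)
          + (2 : ℝ) • ∑ i, R (u x) (V x) (f i) (StatGeom.pullbackConn hat u τ x (e i))
          + ∑ i, StatGeom.nablaThree hat R (u x) (τ x) (V x) (f i) (f i)
          - (2 : ℝ) • ∑ i, R (u x) (f i) (τ x) (StatGeom.pullbackConn hat u V x (e i))
          - StatGeom.nablaTwo (StatGeom.conjugate DN) (StatGeom.differenceTensor DN) (u x)
              (V x) (τ x) (τ x))
        (V x) :=
  hDN.inner_hOp hsymm V e
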